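/- A marked simplicial set $(X,W)$ is a simplicial set $X$ with a set $W\subseteq X_1$ of (marked) 1-simplices containing all degenerate ones; maps of marked simplicial sets are simplicial maps preserving marked 1-simplices. For a simplicial set $K$, let $K^\sharp$ be $K$ with all 1-simplices marked. The set $W$ is weakly closed under composition if every map $(\Lambda^2_1)^\sharp\to(X,W)$ extends to $(\Delta^2)^\sharp$. Write $[n]=\{0<\dots<n\}$; posets are regarded as simplicial sets via the nerve. For $0\le k\le n$, let $\mathrm{L}I^n_k$ be the poset $\{A\subseteq[n] : k\in A\}$ ordered by inclusion, with $A_0\subseteq A_1$ marked when $\max A_0=\max A_1$, and let $\mathrm{R}I^n_k$ be the opposite poset, with $A_0\supseteq A_1$ marked when $\min A_0=\min A_1$. Let $\mathrm{L}J^n_k\subseteq \mathrm{L}I^n_k$ and $\mathrm{R}J^n_k\subseteq \mathrm{R}I^n_k$ be the maximal simplicial subsets omitting the vertex $[n]$, with the restricted markings. Let $\mathrm{sd}_+[n]$ be the poset of non-empty subsets of $[n]$ ordered by inclusion, with $A_0\subseteq A_1$ marked when $\max A_0=\max A_1$, and let $\mathrm{sd}_+^{\mathrm{op}}[n]$ be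 the opposite poset, with $A_0\supseteq A_1$ marked when $\min A_0=\min A_1$; both are cosimplicial marked simplicial sets via direct images. Define simplicial sets $\mathrm{Ex}_+(X,W)$ and $\mathrm{Ex}_+^{\mathrm{op}}(X,W)$ whose $n$-simplices are the marked maps $\mathrm{sd}_+[n]\to(X,W)$, respectively $\mathrm{sd}_+^{\mathrm{op}}[n]\to(X,W)$. The pair $(X,W)$ satisfies CLF (calculus of left fractions) if $W$ is weakly closed under composition and, for all $n\ge2$ and $0<k\le n$, every map $\mathrm{L}J^n_k\to(X,W)$ extends to $\mathrm{L}I^n_k$. It satisfies CRF (calculus of right fractions) if $W$ is weakly closed under composition and, for all $n\ge2$ and $0\le k<n$, every map $\mathrm{R}J^n_k\to(X,W)$ extends to $\mathrm{R}I^n_k$. **Theorem.** Let $(X,W)$ be a marked simplicial set. 1. (a) If $\mathrm{Ex}_+(X,W)$ is a quasicategory, then $(X,W)$ has the right lifting property with respect to $\{\mathrm{L}J^n_k\hookrightarrow \mathrm{L}I^n_k \mid n\ge2,\ 0<k\le n\}$, i.e. every map $\mathrm{L}J^n_k\to(X,W)$ extends to $\mathrm{L}I^n_k$. (b) If $X$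 is a quasicategory and $(X,W)$ satisfies CLF, then $\mathrm{Ex}_+(X,W)$ is a quasicategory. 2. (a) If $\mathrm{Ex}_+^{\mathrm{op}}(X,W)$ is a quasicategory, then $(X,W)$ has the right lifting property with respect to $\{\mathrm{R}J^n_k\hookrightarrow \mathrm{R}I^n_k \mid n\ge2,\ 0\le k<n\}$. (b) If $X$ is a quasicategory and $(X,W)$ satisfies CRF, then $\mathrm{Ex}_+^{\mathrm{op}}(X,W)$ is a quasicategory. -/

import Mathlib

universe u

open CategoryTheory Simplicial Opposite

/-- A marked simplicial set `(X, W)`: a simplicial set `X` with a set `W` of 1-simplices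
containing all the degenerate ones. -/
structure MarkedSSet : Type (u + 1) where
  toSSet : SSet.{u}
  marked : Set (toSSet _⦋1⦌)
  degenerate_mem : ∀ x : toSSet _⦋0⦌, toSSet.σ 0 x ∈ marked

namespace MarkedSSet

/-- Morphisms of marked simplicial sets: simplicial maps which preserve marked 1-simplices. -/
@[ext]
structure Hom (X Y : MarkedSSet.{u}) : Type u where
  hom : X.toSSet ⟶ Y.toSSet
  map_marked : ∀ e ∈ X.marked, hom.app (op ⦋1⦌) e ∈ Y.marked

instance : Category.{u} MarkedSSet.{u} where
  Hom := Hom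
  id X := ⟨𝟙 X.toSSet, fun _ h => h⟩
  comp f g := ⟨f.hom ≫ g.hom, fun e h => g.map_marked _ (f.map_marked e h)⟩

/-- The maximal marking `X♯` of a simplicial set `X`: all 1-simplices are marked. -/
def maximal (X : SSet.{u}) : MarkedSSet.{u} where
  toSSet := X
  marked := Set.univ
  degenerate_mem _ := Set.mem_univ _

/-- The maximal marking on simplicial maps. -/
def maximalMap {X Y : SSet.{u}} (f : X ⟶ Y) : maximal X ⟶ maximal Y :=
  Hom.mk f (fun _ _ => Set.mem_univ _)

/-- A simplicial subset of a marked simplicial set, with the marking induced by restriction. -/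
def ofSubcomplex (X : MarkedSSet.{u}) (A : X.toSSet.Subcomplex) : MarkedSSet.{u} where
  toSSet := A.toSSet
  marked := {e | e.1 ∈ X.marked}
  degenerate_mem x := X.degenerate_mem x.1

/-- The inclusion of a marked simplicial subset. -/
def subcomplexι (X : MarkedSSet.{u}) (A : X.toSSet.Subcomplex) : X.ofSubcomplex A ⟶ X :=
  Hom.mk A.ι (fun _ h => h)

/-- The simplicial subset of `X` of the simplices which do not have `v` among their vertices. -/
def omitVertex (X : SSet.{u}) (v : X _⦋0⦌) : X.Subcomplex where
  obj m := {s | ∀ f : ⦋0⦌ ⟶ m.unop, X.map f.op s ≠ v}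
  map {m m'} g s hs f := by
    have h := hs (f ≫ g.unop)
    rw [op_comp, Functor.map_comp] at h
    exact h

/-- `omitVertex X v` is the maximal simplicial subset of `X` which omits the 0-simplex `v`. -/
theorem le_omitVertex_iff (X : SSet.{u}) (v : X _⦋0⦌) (A : X.Subcomplex) :
    A ≤ omitVertex X v ↔ v ∉ A.obj (op ⦋0⦌) := by
  constructor
  · intro h hv
    have h1 := h (op ⦋0⦌) hv (𝟙 ⦋0⦌)
    rw [op_id, Functor.map_id_apply] at h1
    exact h1 rfl
  · intro h m s hs f hf
    have h1 := A.map f.op hs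
    apply h
    rw [← hf]
    exact h1

/-- `(X, W)` has the right lifting property against `i : A ⟶ B` (the map from `(X, W)` to the
terminal object has it): every map `A ⟶ (X, W)` extends along `i`. -/
def HasRLP (X : MarkedSSet.{u}) {A B : MarkedSSet.{u}} (i : A ⟶ B) : Prop :=
  ∀ f : A ⟶ X, ∃ g : B ⟶ X, i ≫ g = f

/-- `W` is weakly closed under composition: every map `(Λ²₁)♯ ⟶ (X, W)` lifts to `(Δ²)♯`. -/
def WeaklyClosedUnderComposition (X : MarkedSSet.{u}) : Prop :=
  X.HasRLP (maximalMap (SSet.horn.{u} 2 1).ι)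

/-- The nerve of a preorder `P`, where a 1-simplex `a ≤ b` is marked when `f a = f b`. -/
def nerveOf (P : Type u) [Preorder P] {β : Type*} (f : P → β) : MarkedSSet.{u} where
  toSSet := nerve P
  marked := {e | f (ComposableArrows.left e) = f (ComposableArrows.right e)}
  degenerate_mem _ := rfl

/-- The map of marked nerves induced by a monotone map which is compatible with the markings. -/
def nerveOfMap {P Q : Type u} [Preorder P] [Preorder Q] {β γ : Type*} {f : P → β} {g : Q → γ}
    (φ : P →o Q) (h : ∀ a b, f a = f b → g (φ a) = g (φ b)) : nerveOf P f ⟶ nerveOf Q g :=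
  Hom.mk (nerveMap φ.monotone.functor) (fun _ he => h _ _ he)

theorem nerveOfMap_eq_id {P : Type u} [Preorder P] {β : Type*} {f : P → β} (φ : P →o P)
    (h : ∀ a b, f a = f b → f (φ a) = f (φ b)) (hφ : φ = OrderHom.id) :
    nerveOfMap φ h = 𝟙 (nerveOf P f) := by
  subst hφ
  rfl

theorem nerveOfMap_eq_comp {P Q R : Type u} [Preorder P] [Preorder Q] [Preorder R]
    {β γ δ : Type*} {f : P → β} {g : Q → γ} {k : R → δ} (φ : P →o Q) (ψ : Q →o R) (χ : P →o R)
    (h : ∀ a b, f a = f b → g (φ a) = g (φ b)) (h' : ∀ a b, g a = g b → k (ψ a) = k (ψ b))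
    (h'' : ∀ a b, f a = f b → k (χ a) = k (χ b)) (hχ : χ = ψ.comp φ) :
    nerveOfMap χ h'' = nerveOfMap φ h ≫ nerveOfMap ψ h' := by
  subst hχ
  rfl

end MarkedSSet

/-- The powerset of `[n] = {0, ..., n}`, ordered by inclusion (placed in an arbitrary universe). -/
@[ext]
structure PowersetOf (n : ℕ) : Type u where
  finset : Finset (Fin (n + 1))

namespace PowersetOf

instance (n : ℕ) : PartialOrder (PowersetOf.{u} n) :=
  PartialOrder.lift PowersetOf.finset (fun _ _ h => PowersetOf.ext h)

/-- The subset `[n]` of `[n]`. -/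
def top (n : ℕ) : PowersetOf.{u} n := ⟨Finset.univ⟩

/-- The maximum of a subset of `[n]` (`⊥` for the empty subset). -/
def max {n : ℕ} (A : PowersetOf.{u} n) : WithBot (Fin (n + 1)) := A.finset.max

/-- The minimum of a subset of `[n]` (`⊤` for the empty subset). -/
def min {n : ℕ} (A : PowersetOf.{u} n) : WithTop (Fin (n + 1)) := A.finset.min

theorem max_image_congr {m n : ℕ} (φ : Fin (m + 1) →o Fin (n + 1))
    {A B : Finset (Fin (m + 1))} (hA : A.Nonempty) (hB : B.Nonempty) (h : A.max = B.max) :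
    (A.image φ).max = (B.image φ).max := by
  rw [← Finset.coe_max' hA, ← Finset.coe_max' hB, WithBot.coe_inj] at h
  rw [← Finset.coe_max' (hA.image φ), ← Finset.coe_max' (hB.image φ),
    Finset.max'_image φ.monotone, Finset.max'_image φ.monotone, h]

theorem min_image_congr {m n : ℕ} (φ : Fin (m + 1) →o Fin (n + 1))
    {A B : Finset (Fin (m + 1))} (hA : A.Nonempty) (hB : B.Nonempty) (h : A.min = B.min) :
    (A.image φ).min = (B.image φ).min := by
  rw [← Finset.coe_min' hA, ← Finset.coe_min' hB, WithTop.coe_inj] at h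
  rw [← Finset.coe_min' (hA.image φ), ← Finset.coe_min' (hB.image φ),
    Finset.min'_image φ.monotone, Finset.min'_image φ.monotone, h]

end PowersetOf

/-- The poset of the non-empty subsets of `[n]`. -/
abbrev NonemptySubsets (n : ℕ) : Type u := {A : PowersetOf.{u} n // A.finset.Nonempty}

/-- The image of non-empty subsets, as a monotone map. -/
def NonemptySubsets.image {m n : ℕ} (φ : Fin (m + 1) →o Fin (n + 1)) :
    NonemptySubsets.{u} m →o NonemptySubsets.{u} n where
  toFun A := ⟨⟨A.1.finset.image φ⟩, A.2.image φ⟩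
  monotone' _ _ h := Finset.image_subset_image h

theorem NonemptySubsets.image_id (n : ℕ) :
    NonemptySubsets.image.{u} (OrderHom.id : Fin (n + 1) →o Fin (n + 1)) = OrderHom.id := by
  ext A x
  simp [NonemptySubsets.image]

theorem NonemptySubsets.image_comp {l m n : ℕ} (φ : Fin (l + 1) →o Fin (m + 1))
    (ψ : Fin (m + 1) →o Fin (n + 1)) :
    NonemptySubsets.image.{u} (ψ.comp φ) =
      (NonemptySubsets.image.{u} ψ).comp (NonemptySubsets.image.{u} φ) := by
  apply OrderHom.ext
  funext A
  have h : A.1.finset.image (ψ ∘ φ) = (A.1.finset.image φ).image ψ := Finset.image_image.symm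
  exact Subtype.ext (PowersetOf.ext h)

/-- The poset of the subsets of `[n]` which contain `k`. -/
abbrev SubsetsContaining (n : ℕ) (k : Fin (n + 1)) : Type u :=
  {A : PowersetOf.{u} n // k ∈ A.finset}

/-- The subset `[n]`, as a subset containing `k`. -/
def SubsetsContaining.top (n : ℕ) (k : Fin (n + 1)) : SubsetsContaining.{u} n k :=
  ⟨PowersetOf.top n, Finset.mem_univ k⟩

namespace MarkedSSet

/-- The marked simplicial set `L-Iⁿₖ`: (the nerve of) the poset of subsets of `[n]` containing
`k`, where `A₀ ⊆ A₁` is marked when `max A₀ = max A₁`. -/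
def LI (n : ℕ) (k : Fin (n + 1)) : MarkedSSet.{u} :=
  nerveOf (SubsetsContaining.{u} n k) (fun A => A.1.max)

/-- The maximal simplicial subset of `L-Iⁿₖ` which omits the 0-simplex `[n]`. -/
def LJSubcomplex (n : ℕ) (k : Fin (n + 1)) : (LI.{u} n k).toSSet.Subcomplex :=
  omitVertex (nerve (SubsetsContaining.{u} n k))
    (ComposableArrows.mk₀ (SubsetsContaining.top n k))

/-- The marked simplicial set `L-Jⁿₖ`. -/
def LJ (n : ℕ) (k : Fin (n + 1)) : MarkedSSet.{u} := (LI n k).ofSubcomplex (LJSubcomplex n k)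

/-- The inclusion `L-Jⁿₖ ↪ L-Iⁿₖ`. -/
def LJι (n : ℕ) (k : Fin (n + 1)) : LJ.{u} n k ⟶ LI.{u} n k :=
  (LI n k).subcomplexι (LJSubcomplex n k)

/-- The marked simplicial set `R-Iⁿₖ`: the opposite of the simplicial set of `L-Iⁿₖ` (the nerve
of the opposite poset), where `A₀ ⊇ A₁` is marked when `min A₀ = min A₁`. -/
def RI (n : ℕ) (k : Fin (n + 1)) : MarkedSSet.{u} :=
  nerveOf (SubsetsContaining.{u} n k)ᵒᵈ (fun A => (OrderDual.ofDual A).1.min)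

/-- The maximal simplicial subset of `R-Iⁿₖ` which omits the 0-simplex `[n]`. -/
def RJSubcomplex (n : ℕ) (k : Fin (n + 1)) : (RI.{u} n k).toSSet.Subcomplex :=
  omitVertex (nerve (SubsetsContaining.{u} n k)ᵒᵈ)
    (ComposableArrows.mk₀ (OrderDual.toDual (SubsetsContaining.top n k)))

/-- The marked simplicial set `R-Jⁿₖ`. -/
def RJ (n : ℕ) (k : Fin (n + 1)) : MarkedSSet.{u} := (RI n k).ofSubcomplex (RJSubcomplex n k)

/-- The inclusion `R-Jⁿₖ ↪ R-Iⁿₖ`. -/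
def RJι (n : ℕ) (k : Fin (n + 1)) : RJ.{u} n k ⟶ RI.{u} n k :=
  (RI n k).subcomplexι (RJSubcomplex n k)

/-- Calculus of left fractions. -/
structure CLF (X : MarkedSSet.{u}) : Prop where
  weaklyClosed : X.WeaklyClosedUnderComposition
  hasRLP : ∀ (n : ℕ) (k : Fin (n + 1)), 2 ≤ n → 0 < k → X.HasRLP (LJι.{u} n k)

/-- Calculus of right fractions. -/
structure CRF (X : MarkedSSet.{u}) : Prop where
  weaklyClosed : X.WeaklyClosedUnderComposition
  hasRLP : ∀ (n : ℕ) (k : Fin (n + 1)), 2 ≤ n → k < Fin.last n → X.HasRLP (RJι.{u} n k)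

/-- The cosimplicial object `sd₊`: `sd₊ [n]` is the nerve of the poset of non-empty subsets of
`[n]`, where `A₀ ⊆ A₁` is marked when `max A₀ = max A₁`; simplicial operators act by images. -/
def sdPlus : SimplexCategory ⥤ MarkedSSet.{u} where
  obj n := nerveOf (NonemptySubsets.{u} n.len) (fun A => A.1.max)
  map φ := nerveOfMap (NonemptySubsets.image φ.toOrderHom)
    (fun a b h => PowersetOf.max_image_congr φ.toOrderHom a.2 b.2 h)
  map_id n := nerveOfMap_eq_id _ _ (NonemptySubsets.image_id n.len)
  map_comp φ ψ := nerveOfMap_eq_comp _ _ _ _ _ _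
    (NonemptySubsets.image_comp φ.toOrderHom ψ.toOrderHom)

/-- The cosimplicial object `sd₊ᵒᵖ`: `sd₊ᵒᵖ [n]` is the nerve of the opposite of the poset of
non-empty subsets of `[n]`, where `A₀ ⊇ A₁` is marked when `min A₀ = min A₁`. -/
def sdPlusOp : SimplexCategory ⥤ MarkedSSet.{u} where
  obj n := nerveOf (NonemptySubsets.{u} n.len)ᵒᵈ (fun A => (OrderDual.ofDual A).1.min)
  map φ := nerveOfMap (NonemptySubsets.image φ.toOrderHom).dual
    (fun a b h => PowersetOf.min_image_congr φ.toOrderHom (OrderDual.ofDual a).2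
      (OrderDual.ofDual b).2 h)
  map_id n := nerveOfMap_eq_id _ _
    (congrArg (fun f => OrderHom.dual f) (NonemptySubsets.image_id n.len))
  map_comp φ ψ := nerveOfMap_eq_comp _ _ _ _ _ _
    (congrArg (fun f => OrderHom.dual f)
      (NonemptySubsets.image_comp φ.toOrderHom ψ.toOrderHom))

/-- The marked `Ex` functor: `Ex₊(X, W)ₙ` is the set of marked maps `sd₊ [n] ⟶ (X, W)`. -/
def ExPlus : MarkedSSet.{u} ⥤ SSet.{u} :=
  yoneda ⋙ (Functor.whiskeringLeft _ _ _).obj sdPlus.{u}.op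

/-- The functor `Ex₊ᵒᵖ`: `Ex₊ᵒᵖ(X, W)ₙ` is the set of marked maps `sd₊ᵒᵖ [n] ⟶ (X, W)`. -/
def ExPlusOp : MarkedSSet.{u} ⥤ SSet.{u} :=
  yoneda ⋙ (Functor.whiskeringLeft _ _ _).obj sdPlusOp.{u}.op

end MarkedSSet

/-! ### Lifting properties along inclusions of marked simplicial subsets -/

namespace MarkedSSet

variable {X : MarkedSSet.{u}}

/-! By adjunction, filling an inner horn `Λ[n, k]` in `Ex₊(X, W)` amounts to extending a marked map
from a simplicial subset `hornImage` to all of `sd₊ [n]`. A simplex of `sd₊ [n]` lies in `hornImage`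
exactly when its vertices all differ from `[n]` and from `[n] \ {k}` (`mem_hornImage_sdPlus`,
`inHorn_iff`). The adjunction is made concrete by `hasRLP_hornImage` and `quasicategory_exOf`; the
latter needs every simplex of `sd₊ [n]` to come from a smallest face.

(a) If `0 < k < n`, the inclusion `LJ ⊆ LI` is a retract of `hornImage ⊆ sd₊ [n]`, the retraction
being `A ↦ A ∪ {k}`. If `k = n` this horn is outer, so `LI` is instead embedded in `sd₊ [n + 1]` by
adding the new last point; the relevant horn is then the inner one at `n`, and every edge of `LI` is
marked because every vertex contains `n`.

(b) Since `k < n`, sending `[n] \ {k}` to `[n]` preserves maxima, so `[n] \ {k}` may be deleted from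
the poset (`NotCompl`). A map on the chains avoiding `[n]` restricts to `LJ`, extends to `LI` by
hypothesis, and glues to a map on the union of these chains with `LI`. The missing chains contain
`[n]` and some set without `k`. They are matched in pairs by adding or removing `A ∪ {k}`, where `A`
is the largest member without `k`. As `A ⊂ A ∪ {k} ⊂ [n]` strictly, the toggled vertex is interior,
so the matching is an inner regular pairing and the union is inner anodyne in the nerve
(`Toggle.innerAnodyneExtensions`, `isStrictClosure`).

The extension along this inner anodyne map must also respect markings. Marked maps `B ⟶ X` are the
sections of `markedProdFst B X`, which is an inner fibration when `X` is a quasicategory, `W` is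
weakly closed under composition, and a 2-simplex of `B` with marked long edge has all its edges
marked (`hasRLP_of_innerAnodyne`). The last condition holds because maxima are monotone under
inclusion.

The statements for `Ex₊ᵒᵖ` follow in the same way with minima, the exceptional case of (a) being `k
= 0`. -/

theorem hom_ext_app {A B : MarkedSSet.{u}} {f g : A ⟶ B}
    (h : ∀ m (s : A.toSSet.obj m), f.hom.app m s = g.hom.app m s) : f = g := by
  apply Hom.ext
  ext m s
  exact h m s

/-- Lifting against a marked simplicial subset, evaluated on simplices. -/
theorem hasRLP_subcomplexι_iff {B : MarkedSSet.{u}} (A : B.toSSet.Subcomplex) :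
    X.HasRLP (B.subcomplexι A) ↔ ∀ f : B.ofSubcomplex A ⟶ X, ∃ g : B ⟶ X,
      ∀ m (s : B.toSSet.obj m) (hs : s ∈ A.obj m), g.hom.app m s = f.hom.app m ⟨s, hs⟩ := by
  refine forall_congr' fun f => exists_congr fun g => ⟨?_, ?_⟩
  · rintro rfl m s hs
    rfl
  · intro h
    exact hom_ext_app fun m s => h m s.1 s.2

/-- The map of marked simplicial subsets induced by a map of marked simplicial sets. -/
def restrict {B B' : MarkedSSet.{u}} (A : B.toSSet.Subcomplex) (A' : B'.toSSet.Subcomplex)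
    (u : B ⟶ B') (h : A ≤ A'.preimage u.hom) : B.ofSubcomplex A ⟶ B'.ofSubcomplex A' :=
  Hom.mk (SSet.Subcomplex.lift (A.ι ≫ u.hom) (by
    rintro m _ ⟨s, rfl⟩
    exact h m s.2)) (fun e he => u.map_marked e.1 he)

/-- Transfer of the lifting property along maps which restrict to a retraction. -/
theorem HasRLP.transfer {B B' : MarkedSSet.{u}} {A : B.toSSet.Subcomplex}
    {A' : B'.toSSet.Subcomplex} (h : X.HasRLP (B'.subcomplexι A')) (p : B' ⟶ B) (i : B ⟶ B')
    (hp : A' ≤ A.preimage p.hom) (hi : A ≤ A'.preimage i.hom)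
    (hpi : ∀ m (s : B.toSSet.obj m), s ∈ A.obj m → p.hom.app m (i.hom.app m s) = s) :
    X.HasRLP (B.subcomplexι A) := by
  rw [hasRLP_subcomplexι_iff] at h ⊢
  intro f
  -- The extension is `g ∘ i`, where `g` extends `f ∘ p`. Only the restriction of `p ∘ i` to `A`
  -- matters, so `p ∘ i` need not be the identity on all of `B`.
  obtain ⟨g, hg⟩ := h (restrict A' A p hp ≫ f)
  refine ⟨i ≫ g, fun m s hs => ?_⟩
  refine (hg m _ (hi m hs)).trans ?_
  exact congrArg (f.hom.app m) (Subtype.ext (hpi m s hs))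

/-- Maps on two marked simplicial subsets which agree on the intersection glue. -/
theorem exists_glue {B : MarkedSSet.{u}} {A₁ A₂ : B.toSSet.Subcomplex}
    (f₁ : B.ofSubcomplex A₁ ⟶ X) (f₂ : B.ofSubcomplex A₂ ⟶ X)
    (h : ∀ m (s : B.toSSet.obj m) (h₁ : s ∈ A₁.obj m) (h₂ : s ∈ A₂.obj m),
      f₁.hom.app m ⟨s, h₁⟩ = f₂.hom.app m ⟨s, h₂⟩) :
    ∃ f : B.ofSubcomplex (A₁ ⊔ A₂) ⟶ X,
      (∀ m (s : B.toSSet.obj m) (hs : s ∈ A₁.obj m),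
        f.hom.app m ⟨s, Or.inl hs⟩ = f₁.hom.app m ⟨s, hs⟩) ∧
      (∀ m (s : B.toSSet.obj m) (hs : s ∈ A₂.obj m),
        f.hom.app m ⟨s, Or.inr hs⟩ = f₂.hom.app m ⟨s, hs⟩) := by
  have sq : SSet.Subcomplex.BicartSq (A₁ ⊓ A₂) A₁ A₂ (A₁ ⊔ A₂) := ⟨rfl, rfl⟩
  have w : SSet.Subcomplex.homOfLE sq.le₁₂ ≫ f₁.hom = SSet.Subcomplex.homOfLE sq.le₁₃ ≫ f₂.hom := by
    ext m s
    exact h m s.1 s.2.1 s.2.2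
  let φ : (A₁ ⊔ A₂).toSSet ⟶ X.toSSet := sq.isPushout.desc f₁.hom f₂.hom w
  have h₁ : ∀ m (s : B.toSSet.obj m) (hs : s ∈ A₁.obj m),
      φ.app m ⟨s, Or.inl hs⟩ = f₁.hom.app m ⟨s, hs⟩ := fun m s hs =>
    congrArg (fun ψ : A₁.toSSet ⟶ X.toSSet => ψ.app m ⟨s, hs⟩) (sq.isPushout.inl_desc _ _ w)
  have h₂ : ∀ m (s : B.toSSet.obj m) (hs : s ∈ A₂.obj m),
      φ.app m ⟨s, Or.inr hs⟩ = f₂.hom.app m ⟨s, hs⟩ := fun m s hs =>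
    congrArg (fun ψ : A₂.toSSet ⟶ X.toSSet => ψ.app m ⟨s, hs⟩) (sq.isPushout.inr_desc _ _ w)
  refine ⟨Hom.mk φ ?_, h₁, h₂⟩
  rintro ⟨e, he | he⟩ hm
  · exact (h₁ _ e he).symm ▸ f₁.map_marked ⟨e, he⟩ hm
  · exact (h₂ _ e he).symm ▸ f₂.map_marked ⟨e, he⟩ hm

end MarkedSSet

/-! ### Extending marked maps along inner anodyne inclusions -/

namespace MarkedSSet

variable {X : MarkedSSet.{u}}

/-- The simplicial subset of `B × X` of the pairs of simplices `(b, x)` such that the edges of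
`x` are marked when the corresponding edges of `b` are. -/
def markedProd (B X : MarkedSSet.{u}) :
    (MonoidalCategoryStruct.tensorObj B.toSSet X.toSSet).Subcomplex where
  obj m := {s | ∀ e : ⦋1⦌ ⟶ m.unop,
    B.toSSet.map e.op s.1 ∈ B.marked → X.toSSet.map e.op s.2 ∈ X.marked}
  map {m m'} g s hs e := by
    have h := hs (e ≫ g.unop)
    rw [op_comp, Functor.map_comp, Functor.map_comp] at h
    exact h

/-- The projection of `markedProd B X` to `B`. -/
def markedProdFst (B X : MarkedSSet.{u}) : (markedProd B X).toSSet ⟶ B.toSSet :=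
  (markedProd B X).ι ≫ SemiCartesianMonoidalCategory.fst _ _

/-- The projection of `markedProd B X` to `X`. -/
def markedProdSnd (B X : MarkedSSet.{u}) : (markedProd B X).toSSet ⟶ X.toSSet :=
  (markedProd B X).ι ≫ SemiCartesianMonoidalCategory.snd _ _

theorem mem_marked_of_snd (B X : MarkedSSet.{u}) (e : (markedProd B X).toSSet _⦋1⦌)
    (he : (markedProdFst B X).app _ e ∈ B.marked) : (markedProdSnd B X).app _ e ∈ X.marked := by
  have h := e.2 (𝟙 ⦋1⦌)
  rw [op_id, Functor.map_id_apply, Functor.map_id_apply] at h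
  exact h he

/-- A pair of maps which is compatible with the markings gives a map to `markedProd`. -/
def markedProdLift {K : SSet.{u}} {B X : MarkedSSet.{u}} (b : K ⟶ B.toSSet) (x : K ⟶ X.toSSet)
    (h : ∀ e : K _⦋1⦌, b.app _ e ∈ B.marked → x.app _ e ∈ X.marked) :
    K ⟶ (markedProd B X).toSSet :=
  SSet.Subcomplex.lift (CartesianMonoidalCategory.lift b x) (by
    rintro m _ ⟨s, rfl⟩ e he
    have := h (K.map e.op s)
    rw [NatTrans.naturality_apply, NatTrans.naturality_apply] at this
    exact this he)

theorem eq_const_of_not_mono {n : ℕ} (f : ⦋1⦌ ⟶ ⦋n⦌) (hf : ¬ Mono f) :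
    f = SimplexCategory.σ 0 ≫ SimplexCategory.const ⦋0⦌ ⦋n⦌ (f.toOrderHom 0) := by
  have h01 : f.toOrderHom 0 = f.toOrderHom 1 := by
    by_contra hne
    apply hf
    rw [SimplexCategory.mono_iff_injective]
    intro a b hab
    match a, b, hab with
    | 0, 0, _ => rfl
    | 1, 1, _ => rfl
    | 0, 1, hab => exact (hne hab).elim
    | 1, 0, hab => exact (hne hab.symm).elim
  ext a : 3
  match a with
  | 0 => rfl
  | 1 => exact h01.symm

/-- All the edges of a 2-simplex are marked when its three faces are. -/
theorem map_mem_marked_of_δ (X : MarkedSSet.{u}) (x : X.toSSet _⦋2⦌)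
    (h : ∀ i, X.toSSet.δ i x ∈ X.marked) (f : ⦋1⦌ ⟶ ⦋2⦌) : X.toSSet.map f.op x ∈ X.marked := by
  by_cases hf : Mono f
  · obtain ⟨i, rfl⟩ := SimplexCategory.eq_δ_of_mono f
    exact h i
  · rw [eq_const_of_not_mono f hf, op_comp, Functor.map_comp_apply]
    exact X.degenerate_mem _

/-- The only edge of the triangle which is not in the inner horn. -/
theorem eq_δ_of_notMem_horn (f : ⦋1⦌ ⟶ ⦋2⦌)
    (hf : SSet.stdSimplex.objEquiv.symm f ∉ (SSet.horn.{u} 2 1).obj (op ⦋1⦌)) :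
    f = SimplexCategory.δ 1 := by
  by_cases hm : Mono f
  · obtain ⟨i, rfl⟩ := SimplexCategory.eq_δ_of_mono f
    rw [(SSet.objEquiv_symm_δ_notMem_horn_iff.{u} i 1).1 hf]
  · rw [eq_const_of_not_mono f hm] at hf
    refine (hf ?_).elim
    refine (SSet.horn.{u} 2 1).map (SimplexCategory.σ 0).op ?_
      (a := SSet.stdSimplex.objEquiv.symm (SimplexCategory.const ⦋0⦌ ⦋2⦌ (f.toOrderHom 0)))
    rw [SSet.horn_obj_zero]
    exact Set.mem_univ _

theorem WeaklyClosedUnderComposition.exists_extension (hW : X.WeaklyClosedUnderComposition)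
    (σ₀ : (SSet.horn.{u} 2 1).toSSet ⟶ X.toSSet) (h : ∀ e, σ₀.app (op ⦋1⦌) e ∈ X.marked) :
    ∃ σ : Δ[2] ⟶ X.toSSet, (SSet.horn.{u} 2 1).ι ≫ σ = σ₀ ∧ ∀ e, σ.app (op ⦋1⦌) e ∈ X.marked := by
  obtain ⟨g, hg⟩ := hW (Hom.mk σ₀ fun e _ => h e)
  exact ⟨g.hom, congrArg Hom.hom hg, fun e => g.map_marked e (Set.mem_univ _)⟩

/-- The lifting problem for `markedProdFst`, unpacked: `b` is the simplex of the base and `x` the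
horn in `X`. Markings are only an issue in dimension 2, where one edge is missing from the horn. -/
theorem exists_extension_horn [SSet.Quasicategory X.toSSet] (hW : X.WeaklyClosedUnderComposition)
    {B : MarkedSSet.{u}}
    (hB : ∀ s : B.toSSet _⦋2⦌, B.toSSet.δ 1 s ∈ B.marked →
      B.toSSet.δ 0 s ∈ B.marked ∧ B.toSSet.δ 2 s ∈ B.marked)
    {n : ℕ} {i : Fin (n + 3)} (h0 : 0 < i) (hn : i < Fin.last (n + 2))
    (b : Δ[n + 2] ⟶ B.toSSet) (x : (SSet.horn.{u} (n + 2) i).toSSet ⟶ X.toSSet)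
    (h : ∀ e, b.app (op ⦋1⦌) e.1 ∈ B.marked → x.app _ e ∈ X.marked) :
    ∃ σ : Δ[n + 2] ⟶ X.toSSet, (SSet.horn.{u} (n + 2) i).ι ≫ σ = x ∧
      ∀ e, b.app (op ⦋1⦌) e ∈ B.marked → σ.app _ e ∈ X.marked := by
  obtain _ | n := n
  · obtain rfl : i = 1 := by
      fin_cases i
      · exact (lt_irrefl _ h0).elim
      · rfl
      · exact (lt_irrefl _ hn).elim
    -- If every edge lies over a marked one, weak closure gives a marked filler. Otherwise an
    -- arbitrary filler will do.
    by_cases hall : ∀ e, b.app (op ⦋1⦌) e ∈ B.marked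
    · obtain ⟨σ, hσ, hm⟩ := hW.exists_extension x fun e => h e (hall _)
      exact ⟨σ, hσ, fun e _ => hm e⟩
    · obtain ⟨σ, hσ⟩ := SSet.Quasicategory.hornFilling h0 hn x
      refine ⟨σ, hσ.symm, fun e he => ?_⟩
      by_cases hh : e ∈ (SSet.horn.{u} 2 1).obj _
      · have := h ⟨e, hh⟩ he
        rw [hσ] at this
        exact this
      -- The only edge outside the horn is the long one. If it lay over a marked edge, `hB` would
      -- make all edges of the base marked, contrary to the case assumption.
      · exfalso
        apply hall
        obtain ⟨f, rfl⟩ := SSet.stdSimplex.objEquiv.symm.surjective e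
        have key : ∀ f : ⦋1⦌ ⟶ ⦋2⦌, b.app _ (SSet.stdSimplex.objEquiv.symm f) =
            B.toSSet.map f.op (SSet.yonedaEquiv b) := fun f => by
          conv_lhs => rw [← SSet.yonedaEquiv.symm_apply_apply b]
          rfl
        have hf : f = SimplexCategory.δ 1 := eq_δ_of_notMem_horn f hh
        subst hf
        rw [key] at he
        intro e'
        obtain ⟨f', rfl⟩ := SSet.stdSimplex.objEquiv.symm.surjective e'
        rw [key]
        have := hB _ he
        apply map_mem_marked_of_δ
        intro j
        fin_cases j
        exacts [this.1, he, this.2]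
  · obtain ⟨σ, hσ⟩ := SSet.Quasicategory.hornFilling h0 hn x
    refine ⟨σ, hσ.symm, fun e he => ?_⟩
    -- From dimension 3 on, the horn contains every edge, so the marking condition is inherited from
    -- `x`.
    have hh : e ∈ (SSet.horn.{u} (n + 3) i).obj _ := by
      rw [SSet.horn_obj_eq_univ i 1]
      exact Set.mem_univ _
    have := h ⟨e, hh⟩ he
    rw [hσ] at this
    exact this

theorem innerFibrations_markedProdFst {T : MarkedSSet.{u}}
    [SSet.Quasicategory T.toSSet]
    (hW : T.WeaklyClosedUnderComposition) {B : MarkedSSet.{u}}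
    (hB : ∀ s : B.toSSet _⦋2⦌, B.toSSet.δ 1 s ∈ B.marked →
      B.toSSet.δ 0 s ∈ B.marked ∧ B.toSSet.δ 2 s ∈ B.marked) :
    SSet.innerFibrations (markedProdFst B T) := by
  intro K L j hj
  obtain ⟨i, h0, hn⟩ := hj
  constructor
  intro f g sq
  obtain ⟨σ, hσ, hm⟩ := exists_extension_horn hW hB h0 hn g (f ≫ B.markedProdSnd T) (by
    intro e he
    apply mem_marked_of_snd
    have := congrArg (fun φ : _ ⟶ B.toSSet => φ.app _ e) sq.w
    exact this ▸ he)
  refine ⟨⟨⟨markedProdLift (X := T) g σ hm, ?_, ?_⟩⟩⟩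
  · ext m s
    refine Subtype.ext (Prod.ext ?_ ?_)
    · exact (congrArg (fun φ : _ ⟶ B.toSSet => φ.app _ s) sq.w).symm
    · exact congrArg (fun φ : _ ⟶ T.toSSet => φ.app _ s) hσ
  · rfl

/-- Marked maps to a quasicategory with weakly closed marking extend along inner anodyne
extensions which satisfy a condition on the marking. -/
theorem hasRLP_of_innerAnodyne [SSet.Quasicategory X.toSSet]
    (hW : X.WeaklyClosedUnderComposition) {B : MarkedSSet.{u}}
    (hB : ∀ s : B.toSSet _⦋2⦌, B.toSSet.δ 1 s ∈ B.marked →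
      B.toSSet.δ 0 s ∈ B.marked ∧ B.toSSet.δ 2 s ∈ B.marked)
    (A : B.toSSet.Subcomplex) (hA : SSet.innerAnodyneExtensions A.ι) :
    X.HasRLP (B.subcomplexι A) := by
  intro f
  have := hA _ (innerFibrations_markedProdFst hW hB)
  -- A lift in this square is a section of the projection to `B` extending the one given by `f`; its
  -- second component is the required marked map.
  have sq : CommSq (markedProdLift A.ι f.hom f.map_marked) A.ι (markedProdFst B X)
      (𝟙 B.toSSet) := ⟨rfl⟩
  refine ⟨Hom.mk (sq.lift ≫ markedProdSnd B X) fun e he => ?_, ?_⟩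
  · apply mem_marked_of_snd
    exact (congrArg (fun φ : _ ⟶ B.toSSet => φ.app _ e) sq.fac_right).symm ▸ he
  · apply Hom.ext
    exact congrArg (fun φ => φ ≫ markedProdSnd B X) sq.fac_left

end MarkedSSet

/-! ### Nondegenerate simplices of a nerve as finite chains, and pairings by toggling -/

namespace NerveChains

open scoped Classical in
/-- The finite set of the vertices of a simplex of the nerve of a poset. -/
noncomputable def supp {Q : Type u} [PartialOrder Q] {m : SimplexCategoryᵒᵖ}
    (s : (nerve Q).obj m) : Finset Q :=
  Finset.univ.image (fun i => s.obj i)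

section

variable {Q : Type u} [PartialOrder Q]

theorem mem_supp {m : SimplexCategoryᵒᵖ} (s : (nerve Q).obj m) (a : Q) :
    a ∈ supp s ↔ ∃ i, s.obj i = a := by
  simp [supp]

theorem coe_supp {n : ℕ} (s : (nerve Q) _⦋n⦌) : (supp s : Set Q) = Set.range s.obj := by
  ext a
  exact mem_supp s a

theorem isChain_supp {n : ℕ} (s : (nerve Q) _⦋n⦌) : IsChain (· ≤ ·) (supp s : Set Q) := by
  rw [coe_supp]
  rintro _ ⟨i, rfl⟩ _ ⟨j, rfl⟩ _
  exact (le_total i j).imp (fun h => s.monotone h) (fun h => s.monotone h)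

theorem card_supp {n : ℕ} (s : (nerve Q) _⦋n⦌) (hs : s ∈ (nerve Q).nonDegenerate n) :
    (supp s).card = n + 1 := by
  classical
  rw [PartialOrder.mem_nerve_nonDegenerate_iff_injective] at hs
  rw [supp, Finset.card_image_of_injective _ hs]
  simp

theorem exists_nonDegenerate {S : Finset Q} (hS : IsChain (· ≤ ·) (S : Set Q))
    (hne : S.Nonempty) :
    ∃ (n : ℕ) (s : (nerve Q) _⦋n⦌), s ∈ (nerve Q).nonDegenerate n ∧ supp s = S := by
  obtain ⟨n, hn⟩ : ∃ n, S.card = n + 1 := ⟨S.card - 1, by have := hne.card_pos; omega⟩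
  let : LinearOrder S :=
    { (inferInstance : PartialOrder S) with
      le_total := fun a b => hS.total a.2 b.2
      toDecidableLE := Classical.decRel _ }
  let e : Fin (n + 1) ≃o S := Fintype.orderIsoFinOfCardEq S (by simpa using hn)
  have hm : StrictMono (fun i => (e i : Q)) := fun i j h => e.strictMono h
  let s : (nerve Q) _⦋n⦌ := hm.monotone.functor
  refine ⟨n, s, ?_, ?_⟩
  · rw [PartialOrder.mem_nerve_nonDegenerate_iff_strictMono]
    exact hm
  · ext a
    rw [mem_supp]
    constructor
    · rintro ⟨i, rfl⟩
      exact (e i).2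
    · intro ha
      exact ⟨e.symm ⟨a, ha⟩, congrArg Subtype.val (e.apply_symm_apply ⟨a, ha⟩)⟩

theorem supp_subset_iff {n m : ℕ} (s : (nerve Q) _⦋n⦌) (t : (nerve Q) _⦋m⦌)
    (ht : t ∈ (nerve Q).nonDegenerate m) :
    supp s ⊆ supp t ↔ ∃ f : ⦋n⦌ ⟶ ⦋m⦌, (nerve Q).map f.op t = s := by
  rw [PartialOrder.mem_nerve_nonDegenerate_iff_strictMono] at ht
  constructor
  · intro h
    have h' : ∀ i, ∃ j, t.obj j = s.obj i := fun i =>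
      (mem_supp t _).1 (h ((mem_supp s _).2 ⟨i, rfl⟩))
    choose f hf using h'
    have hm : Monotone f := fun i j hij => by
      rw [← ht.le_iff_le, hf, hf]
      exact s.monotone hij
    refine ⟨SimplexCategory.mkHom ⟨f, hm⟩, ?_⟩
    apply nerve.ext_of_isThin
    funext i
    exact hf i
  · rintro ⟨f, rfl⟩ a ha
    rw [mem_supp] at ha ⊢
    obtain ⟨i, rfl⟩ := ha
    exact ⟨f.toOrderHom i, rfl⟩

theorem supp_S_cast (s : (nerve Q).S) {d : ℕ} (hd : s.dim = d) :
    supp (s.cast hd).simplex = supp s.simplex := by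
  subst hd
  rfl

theorem nonDegenerate_S_cast (s : (nerve Q).S) {d : ℕ} (hd : s.dim = d)
    (hs : s.simplex ∈ (nerve Q).nonDegenerate _) :
    (s.cast hd).simplex ∈ (nerve Q).nonDegenerate _ := by
  subst hd
  exact hs

/-- The vertex deleted by the face map is `t`. Having vertices on both sides of it, it is neither
first nor last, which is what makes a pairing inner. -/
theorem index_ne_of_between {n : ℕ} (s : (nerve Q) _⦋n + 1⦌) (hs : StrictMono s.obj)
    (i : Fin (n + 2)) {a b t : Q} (ht : t ∈ supp s) (ht' : t ∉ supp ((nerve Q).δ i s))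
    (ha : a ∈ supp ((nerve Q).δ i s)) (hat : a < t) (hb : b ∈ supp ((nerve Q).δ i s))
    (htb : t < b) : i ≠ 0 ∧ i ≠ Fin.last _ := by
  rw [mem_supp] at ht ha hb
  obtain ⟨j, rfl⟩ := ht
  obtain rfl : j = i := by
    by_contra hne
    obtain ⟨k, rfl⟩ := Fin.exists_succAbove_eq hne
    exact ht' ((mem_supp _ _).2 ⟨k, rfl⟩)
  obtain ⟨a, rfl⟩ := ha
  obtain ⟨b, rfl⟩ := hb
  change s.obj (j.succAbove a) < s.obj j at hat
  change s.obj j < s.obj (j.succAbove b) at htb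
  rw [hs.lt_iff_lt] at hat htb
  exact ⟨(Fin.zero_le _).trans_lt hat |>.ne', (htb.trans_le (Fin.le_last _)).ne⟩

variable {A : (nerve Q).Subcomplex}

/-- A nondegenerate simplex of the nerve of a poset is determined by its vertex set, so face
relations become inclusions of chains. -/
theorem le_iff_supp_subset (x y : A.N) : x ≤ y ↔ supp x.simplex ⊆ supp y.simplex := by
  rw [supp_subset_iff _ _ y.nonDegenerate, SSet.Subcomplex.N.le_iff, SSet.N.le_iff,
    SSet.Subcomplex.ofSimplex_le_iff, SSet.Subcomplex.mem_ofSimplex_obj_iff]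

theorem supp_injective {x y : A.N} (h : supp x.simplex = supp y.simplex) : x = y :=
  le_antisymm ((le_iff_supp_subset _ _).2 h.le) ((le_iff_supp_subset _ _).2 h.ge)

theorem isUniquelyCodimOneFace {x y : A.N} {a : Q} (ha : a ∉ supp x.simplex)
    (h : (supp y.simplex : Set Q) = insert a (supp x.simplex : Set Q)) :
    SSet.S.IsUniquelyCodimOneFace x.toS y.toS := by
  classical
  have h' : supp y.simplex = insert a (supp x.simplex) := by
    ext b
    simpa using Set.ext_iff.1 h b
  refine ⟨?_, SSet.N.existsUnique_of_le (x := x.toN) (y := y.toN) ?_⟩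
  · have h1 := card_supp _ x.nonDegenerate
    have h2 := card_supp _ y.nonDegenerate
    rw [h', Finset.card_insert_of_notMem ha, h1] at h2
    exact (Nat.succ.inj h2).symm
  · rw [← SSet.Subcomplex.N.le_iff, le_iff_supp_subset, h']
    exact Finset.subset_insert _ _

end

open scoped Classical in
/-- Data which matches the finite chains satisfying a predicate in pairs, by adding or removing
an intermediate element. -/
structure Toggle (Q : Type u) [PartialOrder Q] where
  /-- the predicate on finite chains -/
  N : Finset Q → Prop
  /-- the element to be added or removed -/
  t : Finset Q → Q
  /-- a rank function which shows that the matching is regular -/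
  rank : Finset Q → ℕ
  isChain_insert (S : Finset Q) : IsChain (· ≤ ·) (S : Set Q) → N S →
    IsChain (· ≤ ·) (insert (t S) S : Set Q)
  N_insert (S : Finset Q) : IsChain (· ≤ ·) (S : Set Q) → N S → N (insert (t S) S)
  N_erase (S : Finset Q) : IsChain (· ≤ ·) (S : Set Q) → N S → N (S.erase (t S))
  t_insert (S : Finset Q) : IsChain (· ≤ ·) (S : Set Q) → N S → t (insert (t S) S) = t S
  t_erase (S : Finset Q) : IsChain (· ≤ ·) (S : Set Q) → N S → t (S.erase (t S)) = t S
  exists_lt (S : Finset Q) : IsChain (· ≤ ·) (S : Set Q) → N S → ∃ a ∈ S, a < t S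
  exists_gt (S : Finset Q) : IsChain (· ≤ ·) (S : Set Q) → N S → ∃ a ∈ S, t S < a
  -- Here `S'` is an unmatched-side facet of `insert (t S) S` other than `S`, that is, one step of
  -- the ancestral relation in constant dimension. A strictly decreasing rank excludes infinite
  -- sequences of such steps.
  rank_lt (S S' : Finset Q) : IsChain (· ≤ ·) (S : Set Q) → N S → N S' → t S ∉ S → t S' ∉ S' →
    S ≠ S' → S'.card = S.card → S' ⊆ insert (t S) S → rank S' < rank S

namespace Toggle

variable {Q : Type u} [PartialOrder Q] (D : Toggle Q) {A : (nerve Q).Subcomplex}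
  (hA : ∀ (n : ℕ) (s : (nerve Q) _⦋n⦌), s ∈ A.obj _ ↔ ¬ D.N (supp s))

include hA

theorem N_supp (x : A.N) : D.N (supp x.simplex) := by
  have := x.notMem
  rwa [hA, not_not] at this

theorem exists_N {S : Finset Q} (hS : IsChain (· ≤ ·) (S : Set Q)) (hne : S.Nonempty)
    (hN : D.N S) : ∃ x : A.N, supp x.simplex = S := by
  obtain ⟨n, s, hs, rfl⟩ := exists_nonDegenerate hS hne
  refine ⟨SSet.Subcomplex.N.mk s hs ?_, rfl⟩
  rwa [hA, not_not]

open scoped Classical in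
theorem exists_insert (x : A.N) :
    ∃ y : A.N, supp y.simplex = insert (D.t (supp x.simplex)) (supp x.simplex) := by
  have hN := D.N_supp hA x
  refine D.exists_N hA ?_ (Finset.insert_nonempty _ _) (D.N_insert _ (isChain_supp _) hN)
  rw [Finset.coe_insert]
  exact D.isChain_insert _ (isChain_supp _) hN

open scoped Classical in
theorem exists_erase (x : A.N) :
    ∃ y : A.N, supp y.simplex = (supp x.simplex).erase (D.t (supp x.simplex)) := by
  have hN := D.N_supp hA x
  refine D.exists_N hA ((isChain_supp x.simplex).mono ?_) ?_ (D.N_erase _ (isChain_supp _) hN)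
  · exact Finset.coe_subset.2 (Finset.erase_subset _ _)
  · obtain ⟨a, ha, hlt⟩ := D.exists_lt _ (isChain_supp _) hN
    exact ⟨a, Finset.mem_erase.2 ⟨hlt.ne, ha⟩⟩

/-- The pairing of the nondegenerate simplices given by toggling. -/
noncomputable def pairing : A.Pairing where
  I := {x | D.t (supp x.simplex) ∈ supp x.simplex}
  II := {x | D.t (supp x.simplex) ∉ supp x.simplex}
  inter := Set.inter_compl_self _
  union := Set.union_compl_self _
  p := by
    classical
    refine Equiv.ofBijective (fun x => ⟨(D.exists_insert hA x.1).choose, ?_⟩) ⟨?_, ?_⟩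
    · have h := (D.exists_insert hA x.1).choose_spec
      change D.t (supp _) ∈ supp _
      rw [h, D.t_insert _ (isChain_supp _) (D.N_supp hA x.1)]
      exact Finset.mem_insert_self _ _
    · intro x y hxy
      have h1 := (D.exists_insert hA x.1).choose_spec
      have h2 := (D.exists_insert hA y.1).choose_spec
      have hxy' : (D.exists_insert hA x.1).choose = (D.exists_insert hA y.1).choose :=
        congrArg Subtype.val hxy
      rw [hxy'] at h1
      have h3 := h1.symm.trans h2
      have ht := congrArg D.t h3
      rw [D.t_insert _ (isChain_supp _) (D.N_supp hA x.1),
        D.t_insert _ (isChain_supp _) (D.N_supp hA y.1)] at ht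
      apply Subtype.ext
      apply supp_injective
      -- Toggling does not change `t`, so `x` is recovered from `insert (t x) x` by erasing `t`.
      rw [← Finset.erase_insert x.2, ← Finset.erase_insert y.2, h3, ht]
    · rintro ⟨y, hy⟩
      obtain ⟨x, hx⟩ := D.exists_erase hA y
      have ht := D.t_erase _ (isChain_supp _) (D.N_supp hA y)
      have hx' : D.t (supp x.simplex) ∉ supp x.simplex := by
        rw [hx, ht]
        exact Finset.notMem_erase _ _
      refine ⟨⟨x, hx'⟩, Subtype.ext (supp_injective ?_)⟩
      rw [(D.exists_insert hA x).choose_spec, hx, ht, Finset.insert_erase hy]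

open scoped Classical in
theorem supp_p (x : (D.pairing hA).II) :
    supp ((D.pairing hA).p x).1.simplex = insert (D.t (supp x.1.simplex)) (supp x.1.simplex) :=
  (D.exists_insert hA x.1).choose_spec

instance isProper : (D.pairing hA).IsProper where
  isUniquelyCodimOneFace x := isUniquelyCodimOneFace x.2 (by
    classical
    rw [D.supp_p hA x, Finset.coe_insert])

theorem isRegular : (D.pairing hA).IsRegular := by
  classical
  refine SSet.Subcomplex.Pairing.WeakRankFunction.isRegular (α := ℕ)
    ⟨fun x => D.rank (supp x.1.simplex), ?_⟩
  rintro x y ⟨hne, hlt⟩ hdim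
  refine D.rank_lt _ _ (isChain_supp _) (D.N_supp hA y.1) (D.N_supp hA x.1) y.2 x.2 ?_ ?_ ?_
  · intro h
    exact hne (Subtype.ext (supp_injective h.symm))
  · rw [card_supp _ x.1.nonDegenerate, card_supp _ y.1.nonDegenerate, hdim]
  · rw [← D.supp_p hA y]
    exact (le_iff_supp_subset _ _).1 hlt.le

-- `exists_lt` and `exists_gt` place the added vertex strictly between two vertices of the smaller
-- chain. The casts along `hd` only transport these facts to the prescribed dimension.
open scoped Classical in
theorem index_ne (x : (D.pairing hA).II) {d : ℕ} (hd : x.1.dim = d) :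
    ((D.pairing hA).isUniquelyCodimOneFace x).index hd ≠ 0 ∧
      ((D.pairing hA).isUniquelyCodimOneFace x).index hd ≠ Fin.last _ := by
  have hδ := ((D.pairing hA).isUniquelyCodimOneFace x).δ_index hd
  have hy := supp_S_cast ((D.pairing hA).p x).1.toS
    (((D.pairing hA).isUniquelyCodimOneFace x).dim_eq.trans (congrArg (· + 1) hd))
  have hm := nonDegenerate_S_cast ((D.pairing hA).p x).1.toS
    (((D.pairing hA).isUniquelyCodimOneFace x).dim_eq.trans (congrArg (· + 1) hd))
    ((D.pairing hA).p x).1.nonDegenerate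
  rw [PartialOrder.mem_nerve_nonDegenerate_iff_strictMono] at hm
  have hx := supp_S_cast x.1.toS hd
  rw [D.supp_p hA x, ← hx, ← hδ] at hy
  have ht := x.2
  change D.t _ ∉ supp _ at ht
  obtain ⟨a, ha, hat⟩ := D.exists_lt _ (isChain_supp _) (D.N_supp hA x.1)
  obtain ⟨b, hb, htb⟩ := D.exists_gt _ (isChain_supp _) (D.N_supp hA x.1)
  rw [← hx, ← hδ] at ht ha hb hat htb
  refine index_ne_of_between _ hm _ ?_ ht ha hat hb htb
  exact hy.symm ▸ Finset.mem_insert_self _ _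

theorem isInner : (D.pairing hA).IsInner where
  ne_zero x _ hd := (D.index_ne hA x hd).1
  ne_last x _ hd := (D.index_ne hA x hd).2

/-- A simplicial subset of the nerve of a poset is inner anodyne if the finite chains not
belonging to it can be toggled. -/
theorem innerAnodyneExtensions : SSet.innerAnodyneExtensions A.ι := by
  have := D.isRegular hA
  have := D.isInner hA
  exact (D.pairing hA).innerAnodyneExtensions

end Toggle

end NerveChains

/-! ### The matching attached to a strict closure operator -/

namespace NerveChains

namespace Toggle

open scoped Classical in
/-- The same matching, for the opposite poset. -/
def dual {Q : Type u} [PartialOrder Q] (D : Toggle Q) : Toggle Qᵒᵈ where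
  N S := D.N S
  t S := D.t S
  rank S := D.rank S
  isChain_insert S hS h := (D.isChain_insert S hS.symm h).symm
  N_insert S hS h := D.N_insert S hS.symm h
  N_erase S hS h := D.N_erase S hS.symm h
  t_insert S hS h := D.t_insert S hS.symm h
  t_erase S hS h := D.t_erase S hS.symm h
  exists_lt S hS h := D.exists_gt S hS.symm h
  exists_gt S hS h := D.exists_lt S hS.symm h
  rank_lt S S' hS := D.rank_lt S S' hS.symm

end Toggle

/-- A closure operator `c` with values in an upper set `K`, away from the top element `T`. -/
structure IsStrictClosure {Q : Type u} [PartialOrder Q] (K : Set Q) (T : Q) (c : Q → Q) :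
    Prop where
  isUpperSet : IsUpperSet K
  map_mem (a : Q) : a ∉ K → c a ∈ K
  lt_map (a : Q) : a ∉ K → a < c a
  map_lt (a : Q) : a ∉ K → c a < T
  map_le (a b : Q) : a ∉ K → b ∈ K → a ≤ b → c a ≤ b

section

variable {Q : Type u} [PartialOrder Q]

open scoped Classical in
/-- The value of `c` on the greatest element of a chain which is not in `K`. -/
noncomputable def mapGreatest (K : Set Q) (T : Q) (c : Q → Q) (S : Finset Q) : Q :=
  if h : ∃ a ∈ S, a ∉ K ∧ ∀ b ∈ S, b ∉ K → b ≤ a then c h.choose else T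

variable {K : Set Q} {T : Q} {c : Q → Q} {S : Finset Q}

theorem mapGreatest_eq {a : Q} (ha : a ∈ S) (haK : a ∉ K) (h : ∀ b ∈ S, b ∉ K → b ≤ a) :
    mapGreatest K T c S = c a := by
  have hex : ∃ a ∈ S, a ∉ K ∧ ∀ b ∈ S, b ∉ K → b ≤ a := ⟨a, ha, haK, h⟩
  rw [mapGreatest, dif_pos hex]
  congr 1
  exact le_antisymm (h _ hex.choose_spec.1 hex.choose_spec.2.1)
    (hex.choose_spec.2.2 _ ha haK)

theorem exists_greatest (hS : IsChain (· ≤ ·) (S : Set Q)) (h : ∃ a ∈ S, a ∉ K) :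
    ∃ a ∈ S, a ∉ K ∧ ∀ b ∈ S, b ∉ K → b ≤ a := by
  classical
  have hne : (S.filter (· ∉ K)).Nonempty := by
    obtain ⟨a, ha, haK⟩ := h
    exact ⟨a, Finset.mem_filter.2 ⟨ha, haK⟩⟩
  obtain ⟨a, ha⟩ := Finset.exists_maximal hne
  have ha' := Finset.mem_filter.1 ha.1
  refine ⟨a, ha'.1, ha'.2, fun b hb hbK => ?_⟩
  obtain h | h := hS.total hb ha'.1
  · exact h
  · exact ha.2 (Finset.mem_filter.2 ⟨hb, hbK⟩) h

open scoped Classical in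
/-- The matching of the chains which contain `T` and an element not in `K`: the element which
is toggled is the image by `c` of the greatest element not in `K`. -/
noncomputable def IsStrictClosure.toggle (H : IsStrictClosure K T c) : Toggle Q where
  N S := T ∈ S ∧ ∃ a ∈ S, a ∉ K
  t S := mapGreatest K T c S
  rank S := (S.filter (· ∉ K)).card
  isChain_insert S hS h := by
    obtain ⟨a, ha, haK, hmax⟩ := exists_greatest hS h.2
    rw [mapGreatest_eq ha haK hmax]
    refine hS.insert fun b hb _ => ?_
    by_cases hbK : b ∈ K
    · refine Or.inl (H.map_le a b haK hbK ?_)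
      exact (hS.total ha hb).resolve_right fun hba => haK (H.isUpperSet hba hbK)
    · exact Or.inr ((hmax b hb hbK).trans (H.lt_map a haK).le)
  N_insert S _ h := by
    obtain ⟨hT, a, ha, haK⟩ := h
    exact ⟨Finset.mem_insert_of_mem hT, a, Finset.mem_insert_of_mem ha, haK⟩
  N_erase S hS h := by
    obtain ⟨a, ha, haK, hmax⟩ := exists_greatest hS h.2
    rw [mapGreatest_eq ha haK hmax]
    exact ⟨Finset.mem_erase.2 ⟨(H.map_lt a haK).ne', h.1⟩, a,
      Finset.mem_erase.2 ⟨(H.lt_map a haK).ne, ha⟩, haK⟩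
  t_insert S hS h := by
    obtain ⟨a, ha, haK, hmax⟩ := exists_greatest hS h.2
    rw [mapGreatest_eq ha haK hmax]
    refine mapGreatest_eq (Finset.mem_insert_of_mem ha) haK fun b hb hbK => ?_
    obtain rfl | hb := Finset.mem_insert.1 hb
    · exact (hbK (H.map_mem a haK)).elim
    · exact hmax b hb hbK
  t_erase S hS h := by
    obtain ⟨a, ha, haK, hmax⟩ := exists_greatest hS h.2
    rw [mapGreatest_eq ha haK hmax]
    exact mapGreatest_eq (Finset.mem_erase.2 ⟨(H.lt_map a haK).ne, ha⟩) haK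
      fun b hb hbK => hmax b (Finset.mem_of_mem_erase hb) hbK
  exists_lt S hS h := by
    obtain ⟨a, ha, haK, hmax⟩ := exists_greatest hS h.2
    rw [mapGreatest_eq ha haK hmax]
    exact ⟨a, ha, H.lt_map a haK⟩
  exists_gt S hS h := by
    obtain ⟨a, ha, haK, hmax⟩ := exists_greatest hS h.2
    rw [mapGreatest_eq ha haK hmax]
    exact ⟨T, h.1, H.map_lt a haK⟩
  rank_lt S S' hS h h' hS1 hS1' hne hcard hsub := by
    obtain ⟨a, ha, haK, hmax⟩ := exists_greatest hS h.2
    rw [mapGreatest_eq ha haK hmax] at hsub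
    -- The toggled element `c a` lies in `K`, so it cannot contribute to the rank.
    have hsub' : ∀ b ∈ S', b ∉ K → b ∈ S := fun b hb hbK =>
      (Finset.mem_insert.1 (hsub hb)).resolve_left fun hba => hbK (hba ▸ H.map_mem a haK)
    -- If `a` survived in `S'`, both chains would toggle the same element `c a`. Its absence from
    -- `S'` would give `S' ⊆ S`, hence equality by cardinality. So passing to `S'` loses `a`, and
    -- the number of elements outside `K` drops.
    have ha' : a ∉ S' := by
      intro ha'
      rw [mapGreatest_eq ha' haK fun b hb hbK => hmax b (hsub' b hb hbK) hbK] at hS1'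
      exact hne (Finset.eq_of_subset_of_card_le
        ((Finset.subset_insert_iff_of_notMem hS1').1 hsub) hcard.ge).symm
    refine Finset.card_lt_card (Finset.ssubset_iff_subset_ne.2 ⟨fun b hb => ?_, fun heq => ?_⟩)
    · rw [Finset.mem_filter] at hb ⊢
      exact ⟨hsub' b hb.1 hb.2, hb.2⟩
    · have : a ∈ S.filter (· ∉ K) := Finset.mem_filter.2 ⟨ha, haK⟩
      rw [← heq, Finset.mem_filter] at this
      exact ha' this.1

end

end NerveChains

/-! ### Reducing an extension problem from a poset to a subposet -/

namespace MarkedSSet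

open NerveChains

theorem mem_omitVertex_nerve {Q : Type u} [PartialOrder Q] (T : Q) {m : SimplexCategoryᵒᵖ}
    (s : (nerve Q).obj m) :
    s ∈ (omitVertex (nerve Q) (ComposableArrows.mk₀ T)).obj m ↔ ∀ i, s.obj i ≠ T := by
  constructor
  · intro h i hi
    refine h (SimplexCategory.const ⦋0⦌ m.unop i) ?_
    exact ComposableArrows.ext₀ hi
  · intro h f hf
    exact h (f.toOrderHom 0) (congrArg (fun x : ComposableArrows Q 0 => x.obj 0) hf)

theorem mem_range_nerveMap {P Q : Type u} [PartialOrder P] [PartialOrder Q] (φ : P ↪o Q)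
    {m : SimplexCategoryᵒᵖ} (s : (nerve Q).obj m) :
    s ∈ (SSet.Subcomplex.range (nerveMap φ.monotone.functor)).obj m ↔
      ∀ i, s.obj i ∈ Set.range φ := by
  constructor
  · rintro ⟨s, rfl⟩ i
    exact ⟨s.obj i, rfl⟩
  · intro h
    choose t ht using h
    have hm : Monotone t := fun i j hij => by
      rw [← φ.le_iff_le, ht, ht]
      exact s.monotone hij
    refine ⟨hm.functor, ?_⟩
    apply nerve.ext_of_isThin
    funext i
    exact ht i

instance mono_nerveMap {P Q : Type u} [PartialOrder P] [PartialOrder Q] (φ : P ↪o Q) :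
    Mono (nerveMap φ.monotone.functor) := by
  rw [NatTrans.mono_iff_mono_app]
  intro m
  rw [mono_iff_injective]
  intro s t h
  apply nerve.ext_of_isThin
  funext i
  exact φ.injective (congrArg (fun x : ComposableArrows Q m.unop.len => x.obj i) h)

/-- Extension from the simplices omitting a vertex `T`, in terms of the extension property for a
smaller poset. -/
theorem hasRLP_omitVertex {X : MarkedSSet.{u}} [SSet.Quasicategory X.toSSet]
    (hW : X.WeaklyClosedUnderComposition) {P Q : Type u} [PartialOrder P] [PartialOrder Q]
    {β γ : Type*} {p : P → β} {q : Q → γ} (φ : P ↪o Q)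
    (hφ : ∀ a b, p a = p b ↔ q (φ a) = q (φ b))
    (hq : ∀ a b c, a ≤ b → b ≤ c → q a = q c → q a = q b) (T : P)
    (hA : SSet.innerAnodyneExtensions (omitVertex (nerve Q) (ComposableArrows.mk₀ (φ T)) ⊔
      SSet.Subcomplex.range (nerveMap φ.monotone.functor)).ι)
    (h : X.HasRLP ((nerveOf P p).subcomplexι (omitVertex (nerve P) (ComposableArrows.mk₀ T)))) :
    X.HasRLP ((nerveOf Q q).subcomplexι
      (omitVertex (nerve Q) (ComposableArrows.mk₀ (φ T)))) := by
  -- `hq` says that a marked composite has a marked first edge; the second edge is then marked as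
  -- well, since marking is equality of `q`-values.
  have key := hasRLP_of_innerAnodyne hW (B := nerveOf Q q) (fun s hs => by
    have h1 := hq (s.obj 0) (s.obj 1) (s.obj 2) (s.monotone (by decide)) (s.monotone (by decide)) hs
    exact ⟨h1.symm.trans hs, h1⟩) _ hA
  replace h := (hasRLP_subcomplexι_iff _).1 h
  replace key := (hasRLP_subcomplexι_iff _).1 key
  refine (hasRLP_subcomplexι_iff _).2 fun f => ?_
  let ψ : nerveOf P p ⟶ nerveOf Q q := nerveOfMap (φ : P →o Q) fun a b => (hφ a b).1
  have hψ : omitVertex (nerve P) (ComposableArrows.mk₀ T) ≤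
      (omitVertex (nerve Q) (ComposableArrows.mk₀ (φ T))).preimage ψ.hom := by
    intro m s hs
    rw [mem_omitVertex_nerve] at hs
    exact (mem_omitVertex_nerve _ _).2 fun i hi => hs i (φ.injective hi)
  obtain ⟨g, hg⟩ := h (restrict _ _ ψ hψ ≫ f)
  let e := SSet.Subcomplex.toRange (nerveMap φ.monotone.functor)
  have : IsIso e := by
    have := mono_nerveMap φ
    dsimp only [e]
    infer_instance
  let e' := inv e
  have he : ∀ m (s : (nerve P).obj m) hs,
      e'.app m ⟨(nerveMap φ.monotone.functor).app m s, hs⟩ = s := fun m s _ =>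
    congrArg (fun θ : nerve P ⟶ nerve P => θ.app m s) (IsIso.hom_inv_id e)
  -- The extension `g` found on the small poset, transported to the image of `P` in the nerve of
  -- `Q`.
  let g' : (nerveOf Q q).ofSubcomplex (SSet.Subcomplex.range (nerveMap φ.monotone.functor)) ⟶ X :=
    Hom.mk (e' ≫ g.hom) (by
      rintro ⟨_, s, rfl⟩ hs
      refine (congrArg (fun s => g.hom.app _ s ∈ X.marked) (he _ s ⟨s, rfl⟩)).mpr ?_
      exact g.map_marked s ((hφ _ _).2 hs))
  -- On the overlap a simplex comes from a chain of `P` avoiding `T`, where `g` restricts to `f` by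
  -- construction.
  obtain ⟨k, hk, -⟩ := exists_glue f g' (by
    rintro m _ h₁ ⟨s, rfl⟩
    have hs : s ∈ (omitVertex (nerve P) (ComposableArrows.mk₀ T)).obj m := by
      refine (mem_omitVertex_nerve _ _).2 fun i hi => ?_
      exact (mem_omitVertex_nerve _ _).1 h₁ i (congrArg φ hi)
    refine (hg m s hs).symm.trans ?_
    exact (congrArg (fun s => g.hom.app _ s) (he _ s ⟨s, rfl⟩)).symm)
  obtain ⟨l, hl⟩ := key k
  exact ⟨l, fun m s hs => (hl m s (Or.inl hs)).trans (hk m s hs)⟩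

theorem mem_sup_iff_of_range {P Q : Type u} [PartialOrder P] [PartialOrder Q] (φ : P ↪o Q)
    (T : P) (n : ℕ) (s : (nerve Q) _⦋n⦌) :
    s ∈ (omitVertex (nerve Q) (ComposableArrows.mk₀ (φ T)) ⊔
      SSet.Subcomplex.range (nerveMap φ.monotone.functor)).obj _ ↔
      ¬ (φ T ∈ supp s ∧ ∃ a ∈ supp s, a ∉ Set.range φ) := by
  change s ∈ (omitVertex (nerve Q) (ComposableArrows.mk₀ (φ T))).obj _ ∨
      s ∈ (SSet.Subcomplex.range (nerveMap φ.monotone.functor)).obj _ ↔ _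
  rw [mem_omitVertex_nerve, mem_range_nerveMap, not_and_or]
  apply or_congr
  · rw [mem_supp, not_exists]
  · constructor
    · rintro h ⟨a, ha, ha'⟩
      obtain ⟨i, rfl⟩ := (mem_supp s a).1 ha
      exact ha' (h i)
    · intro h i
      by_contra hi
      exact h ⟨_, (mem_supp s _).2 ⟨i, rfl⟩, hi⟩

end MarkedSSet

/-! ### Horns in the right adjoint of a cosimplicial marked simplicial set -/

namespace MarkedSSet

/-- The right adjoint functor attached to a cosimplicial marked simplicial set: the `n`-simplices
of the image of `X` are the marked maps `F [n] ⟶ X`. -/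
abbrev exOf (F : SimplexCategory ⥤ MarkedSSet.{u}) : MarkedSSet.{u} ⥤ SSet.{u} :=
  yoneda ⋙ (Functor.whiskeringLeft _ _ _).obj F.op

/-- The condition that a simplex of `Δ[n]` belongs to the horn `Λ[n, k]`. -/
def IsHornMap {n : ℕ} (k : Fin (n + 1)) {p : SimplexCategory} (a : p ⟶ ⦋n⦌) : Prop :=
  ∃ j, j ≠ k ∧ ∀ i, a.toOrderHom i ≠ j

theorem isHornMap_iff {n : ℕ} (k : Fin (n + 1)) {p : SimplexCategory} (a : p ⟶ ⦋n⦌) :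
    SSet.stdSimplex.objEquiv.symm a ∈ (SSet.horn.{u} n k).obj (op p) ↔ IsHornMap k a := by
  obtain ⟨p, rfl⟩ : ∃ d, p = ⦋d⦌ := ⟨p.len, rfl⟩
  rw [SSet.mem_horn_iff_notMem_range]
  refine exists_congr fun j => ⟨fun ⟨h, h'⟩ => ⟨h, fun i hi => h' ⟨i, hi⟩⟩, fun h => ⟨h.1, ?_⟩⟩
  rintro ⟨i, hi⟩
  exact h.2 i hi

theorem IsHornMap.comp {n : ℕ} {k : Fin (n + 1)} {p q : SimplexCategory} {a : p ⟶ ⦋n⦌}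
    (h : IsHornMap k a) (c : q ⟶ p) : IsHornMap k (c ≫ a) := by
  obtain ⟨j, hj, h⟩ := h
  exact ⟨j, hj, fun i => h _⟩

theorem isHornMap_δ {n : ℕ} {k j : Fin (n + 2)} (h : j ≠ k) :
    IsHornMap k (SimplexCategory.δ j) :=
  ⟨j, h, fun i => Fin.succAbove_ne j i⟩

section

variable (F : SimplexCategory ⥤ MarkedSSet.{u})

/-- The simplicial subset of `F [n]` corresponding to the horn `Λ[n, k]`. -/
def hornImage (n : ℕ) (k : Fin (n + 1)) : (F.obj ⦋n⦌).toSSet.Subcomplex where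
  obj m := {s | ∃ (p : SimplexCategory) (a : p ⟶ ⦋n⦌) (t : (F.obj p).toSSet.obj m),
    IsHornMap k a ∧ (F.map a).hom.app m t = s}
  map g := by
    rintro _ ⟨p, a, t, ha, rfl⟩
    exact ⟨p, a, (F.obj p).toSSet.map g t, ha, NatTrans.naturality_apply (F.map a).hom g t⟩

/-- The map `F [p] ⟶ F [n]` induced by a simplex of the horn factors through `hornImage`. -/
def toHornImage {n : ℕ} {k : Fin (n + 1)} {p : SimplexCategory} {a : p ⟶ ⦋n⦌}
    (ha : IsHornMap k a) : F.obj p ⟶ (F.obj ⦋n⦌).ofSubcomplex (hornImage F n k) :=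
  Hom.mk (SSet.Subcomplex.lift (F.map a).hom (by
    rintro m _ ⟨t, rfl⟩
    exact ⟨p, a, t, ha, rfl⟩)) (F.map a).map_marked

variable {F} {X : MarkedSSet.{u}}

/-- The map from the horn corresponding to a map from `hornImage`. -/
def hornOfMap {n : ℕ} {k : Fin (n + 1)} (f : (F.obj ⦋n⦌).ofSubcomplex (hornImage F n k) ⟶ X) :
    (SSet.horn.{u} n k).toSSet ⟶ (exOf F).obj X where
  app m := ↾fun x => toHornImage F (p := m.unop) (a := SSet.stdSimplex.objEquiv x.1)
    ((isHornMap_iff.{u} k _).1 x.2) ≫ f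
  naturality m m' g := by
    ext x
    apply hom_ext_app
    intro l t
    refine congrArg (f.hom.app l) (Subtype.ext ?_)
    exact congrArg (fun φ : F.obj m'.unop ⟶ F.obj ⦋n⦌ => φ.hom.app l t)
      (F.map_comp g.unop (SSet.stdSimplex.objEquiv x.1))

theorem hasRLP_hornImage (hX : SSet.Quasicategory ((exOf F).obj X)) {n : ℕ} {k : Fin (n + 1)}
    (h0 : 0 < k) (hn : k < Fin.last n) :
    X.HasRLP ((F.obj ⦋n⦌).subcomplexι (hornImage F n k)) := by
  refine (hasRLP_subcomplexι_iff _).2 fun f => ?_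
  obtain ⟨σ, hσ⟩ := hX.hornFilling h0 hn (hornOfMap f)
  let g : F.obj ⦋n⦌ ⟶ X := SSet.yonedaEquiv σ
  refine ⟨g, ?_⟩
  rintro m _ ⟨p, a, t, ha, rfl⟩
  have h1 : F.map a ≫ g = toHornImage F ha ≫ f := by
    have h2 := congrArg (fun φ => φ.app (op p)
      ⟨SSet.stdSimplex.objEquiv.symm a, (isHornMap_iff.{u} k a).2 ha⟩) hσ
    have h3 : σ.app (op p) (SSet.stdSimplex.objEquiv.symm a) = F.map a ≫ g := by
      conv_lhs => rw [← SSet.yonedaEquiv.symm_apply_apply σ]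
      rfl
    rw [← h3]
    exact h2.symm
  exact congrArg (fun φ : F.obj p ⟶ X => φ.hom.app m t) h1

variable (F) in
/-- A cosimplicial marked simplicial set whose simplices are induced from smallest faces. -/
structure HasMinimalFaces : Prop where
  injective {p q : SimplexCategory} (a : p ⟶ q) [Mono a] (m : SimplexCategoryᵒᵖ) :
    Function.Injective ((F.map a).hom.app m)
  mem_marked {p q : SimplexCategory} (a : p ⟶ q) [Mono a] (e : (F.obj p).toSSet _⦋1⦌) :
    (F.map a).hom.app _ e ∈ (F.obj q).marked → e ∈ (F.obj p).marked
  exists_minimal {n : SimplexCategory} {m : SimplexCategoryᵒᵖ} (s : (F.obj n).toSSet.obj m) :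
    ∃ (q : SimplexCategory) (b : q ⟶ n) (t : (F.obj q).toSSet.obj m), Mono b ∧
      (F.map b).hom.app m t = s ∧ ∀ (p : SimplexCategory) (a : p ⟶ n)
        (t' : (F.obj p).toSSet.obj m), Mono a → (F.map a).hom.app m t' = s →
          ∃ c : q ⟶ p, c ≫ a = b

theorem map_comp_app {p q r : SimplexCategory} (c : p ⟶ q) (a : q ⟶ r) {m : SimplexCategoryᵒᵖ}
    (t : (F.obj p).toSSet.obj m) :
    (F.map (c ≫ a)).hom.app m t = (F.map a).hom.app m ((F.map c).hom.app m t) := by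
  rw [F.map_comp]
  rfl

/-- The smallest face carrying a simplex factors through any face carrying it, in particular through
one inside the horn, so it lies in the horn too. -/
theorem HasMinimalFaces.exists_of_mem_hornImage (hF : HasMinimalFaces F) {n : ℕ}
    {k : Fin (n + 1)} {m : SimplexCategoryᵒᵖ} {s : (F.obj ⦋n⦌).toSSet.obj m}
    (hs : s ∈ (hornImage F n k).obj m) :
    ∃ (q : SimplexCategory) (b : q ⟶ ⦋n⦌) (t : (F.obj q).toSSet.obj m), Mono b ∧
      IsHornMap k b ∧
      (F.map b).hom.app m t = s ∧ ∀ (p : SimplexCategory) (a : p ⟶ ⦋n⦌)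
        (t' : (F.obj p).toSSet.obj m), Mono a → (F.map a).hom.app m t' = s →
          ∃ c : q ⟶ p, c ≫ a = b ∧ (F.map c).hom.app m t = t' := by
  obtain ⟨q, b, t, hb, hbs, h⟩ := hF.exists_minimal s
  refine ⟨q, b, t, hb, ?_, hbs, ?_⟩
  · obtain ⟨p, a, t', ⟨j, hj, ha⟩, rfl⟩ := hs
    -- The operator `a` witnessing membership may be degenerate, whereas minimality concerns only
    -- faces; its image is a face missing the same vertex `j`.
    have hfac := Limits.image.fac a
    obtain ⟨c, rfl⟩ := h _ (Limits.image.ι a) ((F.map (Limits.factorThruImage a)).hom.app m t')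
      inferInstance (by rw [← map_comp_app, hfac])
    refine IsHornMap.comp ⟨j, hj, fun i hi => ?_⟩ c
    have := SimplexCategory.epi_iff_surjective.1
      (inferInstance : Epi (Limits.factorThruImage a)) i
    obtain ⟨i, rfl⟩ := this
    apply ha i
    rw [← hfac]
    exact hi
  · intro p a t' hm ha
    obtain ⟨c, rfl⟩ := h p a t' hm ha
    refine ⟨c, rfl, hF.injective a m ?_⟩
    rw [← map_comp_app, hbs, ha]

/-- The value on a simplex of the horn of a map to `(exOf F).obj X`. -/
def hornVal {n : ℕ} {k : Fin (n + 1)} (σ : (SSet.horn.{u} n k).toSSet ⟶ (exOf F).obj X)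
    {p : SimplexCategory} (a : p ⟶ ⦋n⦌) (ha : IsHornMap k a) : F.obj p ⟶ X :=
  σ.app (op p) ⟨SSet.stdSimplex.objEquiv.symm a, (isHornMap_iff.{u} k a).2 ha⟩

theorem hornVal_comp {n : ℕ} {k : Fin (n + 1)}
    (σ : (SSet.horn.{u} n k).toSSet ⟶ (exOf F).obj X)
    {p q : SimplexCategory} (c : q ⟶ p) (a : p ⟶ ⦋n⦌) (ha : IsHornMap k a) :
    hornVal σ (c ≫ a) (ha.comp c) = F.map c ≫ hornVal σ a ha :=
  NatTrans.naturality_apply σ c.op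
    ⟨SSet.stdSimplex.objEquiv.symm a, (isHornMap_iff.{u} k a).2 ha⟩

/-- The values of `σ` on the faces of the horn glue: each simplex gets the value computed on its
smallest face, and any other face containing it gives the same value by naturality. Injectivity and
reflection of markings make the result a marked map. -/
theorem exists_map_of_horn (hF : HasMinimalFaces F) {n : ℕ} {k : Fin (n + 1)}
    (σ : (SSet.horn.{u} n k).toSSet ⟶ (exOf F).obj X) :
    ∃ f : (F.obj ⦋n⦌).ofSubcomplex (hornImage F n k) ⟶ X,
      ∀ (p : SimplexCategory) (a : p ⟶ ⦋n⦌) (ha : IsHornMap k a), Mono a →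
        toHornImage F ha ≫ f = hornVal σ a ha := by
  have key : ∀ m (s : (F.obj ⦋n⦌).toSSet.obj m), s ∈ (hornImage F n k).obj m →
      ∃ x : X.toSSet.obj m, ∀ (p : SimplexCategory) (a : p ⟶ ⦋n⦌) (ha : IsHornMap k a)
        (t : (F.obj p).toSSet.obj m), Mono a → (F.map a).hom.app m t = s →
          (hornVal σ a ha).hom.app m t = x := by
    intro m s hs
    obtain ⟨q, b, t, hb, hb', -, h⟩ := hF.exists_of_mem_hornImage hs
    refine ⟨(hornVal σ b hb').hom.app m t, fun p a ha t' hm hs => ?_⟩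
    obtain ⟨c, rfl, rfl⟩ := h p a t' hm hs
    exact (congrArg (fun φ : F.obj q ⟶ X => φ.hom.app m t) (hornVal_comp σ c a ha)).symm
  choose x hx using key
  let φ : (hornImage F n k).toSSet ⟶ X.toSSet :=
    { app m := ↾fun s => x m s.1 s.2
      naturality m m' g := by
        ext ⟨s, hs⟩
        obtain ⟨q, b, t, hb, hb', rfl, -⟩ := hF.exists_of_mem_hornImage hs
        change x m' _ _ = X.toSSet.map g (x m _ _)
        rw [← hx m _ hs q b hb' t hb rfl, ← NatTrans.naturality_apply]
        exact (hx m' _ _ q b hb' ((F.obj q).toSSet.map g t) hb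
          (NatTrans.naturality_apply _ _ _)).symm }
  refine ⟨Hom.mk φ ?_, fun p a ha hm => ?_⟩
  · rintro ⟨e, he⟩ hme
    change x _ _ _ ∈ _
    obtain ⟨q, b, t, hb, hb', rfl, -⟩ := hF.exists_of_mem_hornImage he
    rw [← hx _ _ he q b hb' t hb rfl]
    exact (hornVal σ b hb').map_marked _ (hF.mem_marked b t hme)
  · exact hom_ext_app fun m t => (hx m _ _ p a ha t hm rfl).symm

/-- A horn filler only has to be checked on the faces `δ j`, which are monomorphisms, so the
description of the glued map on monomorphisms suffices. -/
theorem quasicategory_exOf (hF : HasMinimalFaces F)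
    (h : ∀ (n : ℕ) (k : Fin (n + 1)), 2 ≤ n → 0 < k → k < Fin.last n →
      X.HasRLP ((F.obj ⦋n⦌).subcomplexι (hornImage F n k))) :
    SSet.Quasicategory ((exOf F).obj X) := by
  apply SSet.quasicategory_of_filler
  intro n k σ₀ h0 hn
  obtain ⟨f, hf⟩ := exists_map_of_horn hF σ₀
  obtain ⟨g, hg⟩ := h (n + 2) k (by omega) h0 hn f
  refine ⟨g, fun j hj => ?_⟩
  have h1 := hf _ _ (isHornMap_δ hj) inferInstance
  rw [← hg] at h1
  exact h1

end

end MarkedSSet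

/-! ### Combinatorics of non-empty subsets: faces and horns -/

namespace NonemptySubsets

section

variable {m n : ℕ}

theorem max_eq_last {S : Finset (Fin (n + 1))} (h : Fin.last n ∈ S) :
    S.max = (Fin.last n : Fin (n + 1)) :=
  le_antisymm (Finset.max_le fun a _ => WithBot.coe_le_coe.2 (Fin.le_last a)) (Finset.le_max h)

theorem min_eq_zero {S : Finset (Fin (n + 1))} (h : 0 ∈ S) : S.min = (0 : Fin (n + 1)) :=
  le_antisymm (Finset.min_le h) (Finset.le_min fun a _ => WithTop.coe_le_coe.2 (Fin.zero_le a))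

theorem ext_finset {A B : NonemptySubsets.{u} n} (h : A.1.finset = B.1.finset) : A = B :=
  Subtype.ext (PowersetOf.ext h)

theorem image_le_image_iff (φ : Fin (m + 1) →o Fin (n + 1)) (hφ : Function.Injective φ)
    {A B : NonemptySubsets.{u} m} : image φ A ≤ image φ B ↔ A ≤ B :=
  Finset.image_subset_image_iff hφ

theorem image_injective (φ : Fin (m + 1) →o Fin (n + 1)) (hφ : Function.Injective φ) :
    Function.Injective (image.{u} φ) := fun _ _ h =>
  ext_finset (Finset.image_injective hφ (congrArg (fun C : NonemptySubsets n => C.1.finset) h))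

theorem exists_image_eq (φ : Fin (m + 1) →o Fin (n + 1)) (A : NonemptySubsets.{u} n)
    (h : ∀ x ∈ A.1.finset, x ∈ Set.range φ) : ∃ B, image φ B = A := by
  have hAB : (Finset.univ.filter (φ · ∈ A.1.finset)).image φ = A.1.finset := by
    ext x
    simp only [Finset.mem_image, Finset.mem_filter, Finset.mem_univ, true_and]
    constructor
    · rintro ⟨y, hy, rfl⟩
      exact hy
    · intro hx
      obtain ⟨y, rfl⟩ := h x hx
      exact ⟨y, hx, rfl⟩
  exact ⟨⟨⟨_⟩, Finset.image_nonempty.1 (hAB ▸ A.2)⟩, ext_finset hAB⟩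

theorem max_eq_of_image (φ : Fin (m + 1) →o Fin (n + 1)) (hφ : Function.Injective φ)
    {A B : NonemptySubsets.{u} m} (h : (image φ A).1.max = (image φ B).1.max) :
    A.1.max = B.1.max := by
  change (A.1.finset.image φ).max = (B.1.finset.image φ).max at h
  rw [← Finset.coe_max' (A.2.image φ), ← Finset.coe_max' (B.2.image φ),
    Finset.max'_image φ.monotone, Finset.max'_image φ.monotone, WithBot.coe_inj] at h
  exact (Finset.coe_max' A.2).symm.trans ((congrArg _ (hφ h)).trans (Finset.coe_max' B.2))

theorem min_eq_of_image (φ : Fin (m + 1) →o Fin (n + 1)) (hφ : Function.Injective φ)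
    {A B : NonemptySubsets.{u} m} (h : (image φ A).1.min = (image φ B).1.min) :
    A.1.min = B.1.min := by
  change (A.1.finset.image φ).min = (B.1.finset.image φ).min at h
  rw [← Finset.coe_min' (A.2.image φ), ← Finset.coe_min' (B.2.image φ),
    Finset.min'_image φ.monotone, Finset.min'_image φ.monotone, WithTop.coe_inj] at h
  exact (Finset.coe_min' A.2).symm.trans ((congrArg _ (hφ h)).trans (Finset.coe_min' B.2))

/-- A finite family of non-empty subsets comes from a smallest face. -/
theorem exists_minimal_face {ι : Type*} [Fintype ι] [Nonempty ι]
    (s : ι → NonemptySubsets.{u} n) :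
    ∃ (q : ℕ) (b : Fin (q + 1) →o Fin (n + 1)) (t : ι → NonemptySubsets.{u} q),
      Function.Injective b ∧ (∀ i, image b (t i) = s i) ∧
        ∀ (p : ℕ) (a : Fin (p + 1) →o Fin (n + 1)) (t' : ι → NonemptySubsets.{u} p),
          Function.Injective a → (∀ i, image a (t' i) = s i) →
            ∃ c : Fin (q + 1) →o Fin (p + 1), a.comp c = b := by
  -- The smallest face is spanned by the union of the family.
  let S : Finset (Fin (n + 1)) := Finset.univ.biUnion fun i => (s i).1.finset
  have hS : S.Nonempty := by
    obtain ⟨x, hx⟩ := (s (Classical.arbitrary ι)).2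
    exact ⟨x, Finset.mem_biUnion.2 ⟨_, Finset.mem_univ _, hx⟩⟩
  obtain ⟨q, hq⟩ : ∃ q, S.card = q + 1 := ⟨S.card - 1, by have := hS.card_pos; omega⟩
  let b := S.orderEmbOfFin hq
  have hb : Set.range b = S := Finset.range_orderEmbOfFin S hq
  have ht : ∀ i, ∃ t, image (b : Fin (q + 1) →o Fin (n + 1)) t = s i := fun i =>
    exists_image_eq _ _ fun x hx => by
      change x ∈ Set.range b
      rw [hb]
      exact Finset.mem_biUnion.2 ⟨i, Finset.mem_univ _, hx⟩
  choose t ht using ht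
  refine ⟨q, b, t, b.injective, ht, fun p a t' ha h => ?_⟩
  have hc : ∀ x, ∃ y, a y = b x := by
    intro x
    have hx : b x ∈ (S : Set (Fin (n + 1))) := hb ▸ ⟨x, rfl⟩
    obtain ⟨i, -, hi⟩ := Finset.mem_biUnion.1 hx
    rw [← h i] at hi
    obtain ⟨y, -, hy⟩ := Finset.mem_image.1 hi
    exact ⟨y, hy⟩
  choose c hc using hc
  have hm : StrictMono a := a.monotone.strictMono_of_injective ha
  refine ⟨⟨c, fun x y hxy => ?_⟩, OrderHom.ext _ _ (funext hc)⟩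
  rw [← hm.le_iff_le, hc, hc]
  exact b.monotone hxy

/-- The condition that a non-empty subset belongs to the horn. -/
def InHorn (k : Fin (n + 1)) (A : NonemptySubsets.{u} n) : Prop :=
  ∃ j, j ≠ k ∧ j ∉ A.1.finset

theorem inHorn_image {p : ℕ} {k : Fin (n + 1)} (a : Fin (p + 1) →o Fin (n + 1))
    (ha : ∃ j, j ≠ k ∧ ∀ i, a i ≠ j) (A : NonemptySubsets.{u} p) : InHorn k (image a A) := by
  obtain ⟨j, hj, ha⟩ := ha
  refine ⟨j, hj, fun h => ?_⟩
  obtain ⟨i, -, hi⟩ := Finset.mem_image.1 h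
  exact ha i hi

/-- A point missed by the largest member is missed by all, so the whole family lies in the face
opposite to it. -/
theorem exists_face_of_inHorn {ι : Type*} {k : Fin (n + 1)} (s : ι → NonemptySubsets.{u} n)
    (i₀ : ι) (hi₀ : ∀ i, s i ≤ s i₀) (h : InHorn k (s i₀)) :
    ∃ (p : ℕ) (a : Fin (p + 1) →o Fin (n + 1)) (t : ι → NonemptySubsets.{u} p),
      (∃ j, j ≠ k ∧ ∀ i, a i ≠ j) ∧ Function.Injective a ∧ ∀ i, image a (t i) = s i := by
  obtain ⟨j, hj, hjs⟩ := h
  obtain _ | n := n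
  · exact (hj (Subsingleton.elim (α := Fin 1) _ _)).elim
  have ht : ∀ i, ∃ t, image (Fin.succAboveOrderEmb j : Fin (n + 1) →o Fin (n + 2)) t = s i :=
    fun i => exists_image_eq _ _ fun x hx => by
      change x ∈ Set.range j.succAbove
      rw [Fin.range_succAbove]
      rintro rfl
      exact hjs (hi₀ i hx)
  choose t ht using ht
  exact ⟨n, _, t, ⟨j, hj, fun i => Fin.succAbove_ne j i⟩, (Fin.succAboveOrderEmb j).injective, ht⟩

theorem inHorn_iff {k : Fin (n + 1)} (A : NonemptySubsets.{u} n) :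
    InHorn k A ↔ A.1.finset ≠ Finset.univ ∧ A.1.finset ≠ Finset.univ.erase k := by
  constructor
  · rintro ⟨j, hj, hA⟩
    constructor
    · intro h
      exact hA (h ▸ Finset.mem_univ j)
    · intro h
      exact hA (h ▸ Finset.mem_erase.2 ⟨hj, Finset.mem_univ j⟩)
  · rintro ⟨h1, h2⟩
    by_contra h
    have h' : ∀ j, j ≠ k → j ∈ A.1.finset := fun j hj => by
      by_contra hj'
      exact h ⟨j, hj, hj'⟩
    by_cases hk : k ∈ A.1.finset
    · refine h1 (Finset.eq_univ_iff_forall.2 fun j => ?_)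
      by_cases hj : j = k
      · exact hj ▸ hk
      · exact h' j hj
    · refine h2 (Finset.ext fun j => ?_)
      rw [Finset.mem_erase]
      constructor
      · intro hj
        exact ⟨fun h => hk (h ▸ hj), Finset.mem_univ j⟩
      · intro hj
        exact h' j hj.1

end

/-! ### The retractions and the closure operator on posets of subsets -/

section

variable {n : ℕ} (k : Fin (n + 1))

/-- A subset containing `k`, as a non-empty subset. -/
def ofContaining : SubsetsContaining.{u} n k →o NonemptySubsets.{u} n where
  toFun A := ⟨A.1, ⟨k, A.2⟩⟩
  monotone' _ _ h := h

/-- The addition of the element `k` to a subset. -/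
def insertElement : NonemptySubsets.{u} n →o SubsetsContaining.{u} n k where
  toFun A := ⟨⟨insert k A.1.finset⟩, Finset.mem_insert_self _ _⟩
  monotone' _ _ h := Finset.insert_subset_insert k h

theorem insertElement_ofContaining (A : SubsetsContaining.{u} n k) :
    insertElement k (ofContaining k A) = A :=
  Subtype.ext (PowersetOf.ext (Finset.insert_eq_of_mem A.2))

theorem insertElement_ne_top (A : NonemptySubsets.{u} n) (h : InHorn k A) :
    insertElement k A ≠ SubsetsContaining.top n k := by
  obtain ⟨j, hj, hA⟩ := h
  intro h
  have h' : insert k A.1.finset = Finset.univ :=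
    congrArg (fun B : SubsetsContaining n k => B.1.finset) h
  exact (Finset.mem_insert.1 (h' ▸ Finset.mem_univ j)).elim hj hA

theorem inHorn_ofContaining (A : SubsetsContaining.{u} n k)
    (h : A ≠ SubsetsContaining.top n k) : InHorn k (ofContaining k A) := by
  rw [inHorn_iff]
  refine ⟨fun h' => h (Subtype.ext (PowersetOf.ext h')), fun h' => ?_⟩
  have := A.2
  change A.1.finset = _ at h'
  rw [h'] at this
  exact Finset.notMem_erase _ _ this

variable (z : Fin (n + 2))

/-- The image of a subset by the inclusion missing `z`, with `z` added. -/
def addPoint : SubsetsContaining.{u} n k →o NonemptySubsets.{u} (n + 1) where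
  toFun A := ⟨⟨insert z (A.1.finset.image z.succAbove)⟩, Finset.insert_nonempty _ _⟩
  monotone' _ _ h := Finset.insert_subset_insert z (Finset.image_subset_image h)

/-- A retraction of `addPoint`. -/
def removePoint : NonemptySubsets.{u} (n + 1) →o SubsetsContaining.{u} n k where
  toFun A := ⟨⟨insert k (Finset.univ.filter fun x => z ∈ A.1.finset ∧
    z.succAbove x ∈ A.1.finset)⟩, Finset.mem_insert_self _ _⟩
  monotone' A B h := Finset.insert_subset_insert k fun x hx => by
    rw [Finset.mem_filter] at hx ⊢
    exact ⟨hx.1, h hx.2.1, h hx.2.2⟩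

theorem mem_removePoint (A : NonemptySubsets.{u} (n + 1)) (x : Fin (n + 1)) :
    x ∈ (removePoint k z A).1.finset ↔ x = k ∨ z ∈ A.1.finset ∧ z.succAbove x ∈ A.1.finset := by
  change x ∈ insert k (Finset.univ.filter _) ↔ _
  rw [Finset.mem_insert, Finset.mem_filter, and_iff_right (Finset.mem_univ x)]

theorem removePoint_addPoint (A : SubsetsContaining.{u} n k) :
    removePoint k z (addPoint k z A) = A := by
  refine Subtype.ext (PowersetOf.ext (Finset.ext fun x => ?_))
  have h : x ∈ (removePoint k z (addPoint k z A)).1.finset ↔ x = k ∨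
      z ∈ insert z (A.1.finset.image z.succAbove) ∧
      z.succAbove x ∈ insert z (A.1.finset.image z.succAbove) := mem_removePoint k z _ x
  rw [h]
  simp only [Finset.mem_insert_self, true_and, Finset.mem_insert, Fin.succAbove_ne, false_or,
    Finset.mem_image, Fin.succAbove_right_inj, exists_eq_right]
  exact ⟨fun h => h.elim (fun h => h ▸ A.2) id, Or.inr⟩

theorem removePoint_ne_top (hn : 1 ≤ n) (A : NonemptySubsets.{u} (n + 1))
    (h : InHorn (z.succAbove k) A) : removePoint k z A ≠ SubsetsContaining.top n k := by
  obtain ⟨j, hj, hA⟩ := h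
  intro h
  have h' : ∀ x, x = k ∨ z ∈ A.1.finset ∧ z.succAbove x ∈ A.1.finset := fun x =>
    (mem_removePoint k z A x).1 (h ▸ Finset.mem_univ x)
  -- If `z ∈ A`, the point missing from `A` is `z.succAbove x` for some `x ≠ k`, and `x` is missing
  -- from the image. If `z ∉ A`, the image is only `{k}`, which is not everything as `1 ≤ n`.
  by_cases hz : z ∈ A.1.finset
  · obtain ⟨x, rfl⟩ := Fin.exists_succAbove_eq (x := j) (y := z) (fun h => hA (h ▸ hz))
    obtain rfl | hx := h' x
    · exact hj rfl
    · exact hA hx.2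
  · have : Nontrivial (Fin (n + 1)) := Fin.nontrivial_iff_two_le.2 (by omega)
    obtain ⟨x, hx⟩ := exists_ne k
    exact hz ((h' x).resolve_left hx).1

theorem inHorn_addPoint (A : SubsetsContaining.{u} n k)
    (h : A ≠ SubsetsContaining.top n k) : InHorn (z.succAbove k) (addPoint k z A) := by
  obtain ⟨j, hj, hA⟩ := inHorn_ofContaining k A h
  refine ⟨z.succAbove j, Fin.succAbove_right_injective.ne hj, fun h => ?_⟩
  obtain h | h := Finset.mem_insert.1 h
  · exact Fin.succAbove_ne z j h
  · obtain ⟨x, hx, hxj⟩ := Finset.mem_image.1 h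
    exact hA (Fin.succAbove_right_injective hxj ▸ hx)

/-- The non-empty subsets which are not the complement of `k`. -/
abbrev NotCompl : Type u := {A : NonemptySubsets.{u} n // A.1.finset ≠ Finset.univ.erase k}

/-- A subset containing `k`, as an element of `NotCompl k`. -/
def containingEmb : SubsetsContaining.{u} n k ↪o NotCompl.{u} k where
  toFun A := ⟨ofContaining k A, fun h => by
    have := A.2
    change A.1.finset = _ at h
    rw [h] at this
    exact Finset.notMem_erase _ _ this⟩
  inj' A B h := Subtype.ext (congrArg (fun C : NotCompl k => C.1.1) h)
  map_rel_iff' := Iff.rfl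

theorem mem_range_containingEmb (A : NotCompl.{u} k) :
    A ∈ Set.range (containingEmb k) ↔ k ∈ A.1.1.finset := by
  constructor
  · rintro ⟨A, rfl⟩
    exact A.2
  · intro h
    exact ⟨⟨A.1.1, h⟩, rfl⟩

/-- The addition of the element `k`, as an operation on `NotCompl k`. -/
def insertClosure (A : NotCompl.{u} k) : NotCompl.{u} k := containingEmb k (insertElement k A.1)

/-- Adding `k` is a closure operator onto the sets containing `k`. Strictness below `[n]` is where
the deletion of `[n] \ {k}` is essential: it is the only set without `k` that `k` completes to
`[n]`. -/
theorem isStrictClosure : NerveChains.IsStrictClosure (Set.range (containingEmb.{u} k))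
    (containingEmb k (SubsetsContaining.top n k)) (insertClosure k) where
  isUpperSet A B h hA := by
    rw [mem_range_containingEmb] at hA ⊢
    exact h hA
  map_mem A _ := ⟨_, rfl⟩
  lt_map A hA := by
    rw [mem_range_containingEmb] at hA
    refine lt_of_le_of_ne (Finset.subset_insert k _) fun h => hA ?_
    rw [h]
    exact Finset.mem_insert_self _ _
  map_lt A hA := by
    rw [mem_range_containingEmb] at hA
    refine lt_of_le_of_ne (Finset.subset_univ _) fun h => A.2 ?_
    have h' : insert k A.1.1.finset = Finset.univ :=
      congrArg (fun B : NotCompl k => B.1.1.finset) h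
    exact (Finset.erase_insert hA).symm.trans (congrArg (Finset.erase · k) h')
  map_le A B _ hB h := by
    rw [mem_range_containingEmb] at hB
    exact Finset.insert_subset hB h

open scoped Classical in
/-- The retraction to `NotCompl k` which sends the complement of `k` to the full subset. -/
noncomputable def toNotCompl : NonemptySubsets.{u} n →o NotCompl.{u} k where
  toFun A := if h : A.1.finset ≠ Finset.univ.erase k then ⟨A, h⟩ else
    containingEmb k (SubsetsContaining.top n k)
  monotone' A B h := by
    by_cases hB : B.1.finset ≠ Finset.univ.erase k
    · by_cases hA : A.1.finset ≠ Finset.univ.erase k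
      · simp only [dif_pos hA, dif_pos hB]
        exact h
      · have hBu : B.1.finset = Finset.univ := by
          by_contra hBu
          obtain ⟨j, hj, hjB⟩ := (inHorn_iff (k := k) B).2 ⟨hBu, hB⟩
          rw [not_not] at hA
          exact hjB (h (hA ▸ Finset.mem_erase.2 ⟨hj, Finset.mem_univ j⟩))
        simp only [dif_neg hA, dif_pos hB]
        exact hBu.ge
    · simp only [dif_neg hB]
      exact Finset.subset_univ _

theorem toNotCompl_of_ne {A : NonemptySubsets.{u} n} (h : A.1.finset ≠ Finset.univ.erase k) :
    toNotCompl k A = ⟨A, h⟩ :=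
  dif_pos h

theorem toNotCompl_of_eq {A : NonemptySubsets.{u} n} (h : A.1.finset = Finset.univ.erase k) :
    toNotCompl k A = containingEmb k (SubsetsContaining.top n k) :=
  dif_neg (not_not.2 h)

/-- Only the complement of `k` is moved, to `[n]`; both have maximum `n` because `k` is not last. -/
theorem max_toNotCompl (hk : k < Fin.last n) (A : NonemptySubsets.{u} n) :
    (toNotCompl k A).1.1.max = A.1.max := by
  by_cases hA : A.1.finset ≠ Finset.univ.erase k
  · rw [toNotCompl_of_ne k hA]
  · rw [not_not] at hA
    rw [toNotCompl_of_eq k hA]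
    refine (max_eq_last (Finset.mem_univ _)).trans (max_eq_last ?_).symm
    rw [hA]
    exact Finset.mem_erase.2 ⟨hk.ne', Finset.mem_univ _⟩

theorem min_toNotCompl (hk : 0 < k) (A : NonemptySubsets.{u} n) :
    (toNotCompl k A).1.1.min = A.1.min := by
  by_cases hA : A.1.finset ≠ Finset.univ.erase k
  · rw [toNotCompl_of_ne k hA]
  · rw [not_not] at hA
    rw [toNotCompl_of_eq k hA]
    refine (min_eq_zero (Finset.mem_univ _)).trans (min_eq_zero ?_).symm
    rw [hA]
    exact Finset.mem_erase.2 ⟨hk.ne, Finset.mem_univ _⟩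

end

end NonemptySubsets

/-! ### Application to `sdPlus` and `sdPlusOp`, and the main theorem -/

namespace MarkedSSet

open NonemptySubsets

theorem hasMinimalFaces_sdPlus : HasMinimalFaces sdPlus.{u} where
  injective {p q} a _ m s t h :=
    nerve.ext_of_isThin (funext fun i => image_injective a.toOrderHom
      (SimplexCategory.mono_iff_injective.1 ‹Mono a›)
      (congrArg (fun s : (nerve (NonemptySubsets.{u} q.len)).obj m => s.obj i) h))
  mem_marked a _ e h :=
    max_eq_of_image a.toOrderHom (SimplexCategory.mono_iff_injective.1 ‹Mono a›) h
  exists_minimal {n m} s := by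
    change (nerve (NonemptySubsets.{u} n.len)).obj m at s
    obtain ⟨q, b, t, hb, ht, h⟩ := exists_minimal_face s.obj
    have htm : Monotone t := fun i j hij => by
      rw [← image_le_image_iff b hb, ht, ht]
      exact s.monotone hij
    refine ⟨⦋q⦌, SimplexCategory.Hom.mk b, htm.functor, SimplexCategory.mono_iff_injective.2 hb,
      nerve.ext_of_isThin (funext ht), fun p a t' ha hs => ?_⟩
    obtain ⟨c, hc⟩ := h p.len a.toOrderHom (fun i => t'.obj i)
      (SimplexCategory.mono_iff_injective.1 ha)
      (fun i => congrArg (fun s : (nerve (NonemptySubsets.{u} n.len)).obj m => s.obj i) hs)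
    exact ⟨SimplexCategory.Hom.mk c, SimplexCategory.Hom.ext _ _ hc⟩

theorem hasMinimalFaces_sdPlusOp : HasMinimalFaces sdPlusOp.{u} where
  injective {p q} a _ m s t h :=
    nerve.ext_of_isThin (funext fun i => image_injective a.toOrderHom
      (SimplexCategory.mono_iff_injective.1 ‹Mono a›)
      (congrArg (fun s : (nerve (NonemptySubsets.{u} q.len)ᵒᵈ).obj m => s.obj i) h))
  mem_marked a _ e h :=
    min_eq_of_image a.toOrderHom (SimplexCategory.mono_iff_injective.1 ‹Mono a›) h
  exists_minimal {n m} s := by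
    change (nerve (NonemptySubsets.{u} n.len)ᵒᵈ).obj m at s
    obtain ⟨q, b, t, hb, ht, h⟩ := exists_minimal_face fun i => OrderDual.ofDual (s.obj i)
    have htm : Monotone fun i => OrderDual.toDual (t i) := fun i j hij => by
      change t j ≤ t i
      rw [← image_le_image_iff b hb, ht, ht]
      exact s.monotone hij
    refine ⟨⦋q⦌, SimplexCategory.Hom.mk b, htm.functor, SimplexCategory.mono_iff_injective.2 hb,
      nerve.ext_of_isThin (funext ht), fun p a t' ha hs => ?_⟩
    obtain ⟨c, hc⟩ := h p.len a.toOrderHom (fun i => OrderDual.ofDual (t'.obj i))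
      (SimplexCategory.mono_iff_injective.1 ha)
      (fun i => congrArg (fun s : (nerve (NonemptySubsets.{u} n.len)ᵒᵈ).obj m => s.obj i) hs)
    exact ⟨SimplexCategory.Hom.mk c, SimplexCategory.Hom.ext _ _ hc⟩

theorem mem_hornImage_sdPlus {n : ℕ} {k : Fin (n + 1)} {m : SimplexCategoryᵒᵖ}
    (s : (nerve (NonemptySubsets.{u} n)).obj m) :
    s ∈ (hornImage sdPlus.{u} n k).obj m ↔ ∀ i, InHorn k (s.obj i) := by
  constructor
  · rintro ⟨p, a, t, ha, rfl⟩ i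
    exact inHorn_image a.toOrderHom ha (t.obj i)
  · intro h
    obtain ⟨p, a, t, ha, ha', ht⟩ := exists_face_of_inHorn s.obj (Fin.last _)
      (fun i => s.monotone (Fin.le_last i)) (h _)
    have htm : Monotone t := fun i j hij => by
      rw [← image_le_image_iff a ha', ht, ht]
      exact s.monotone hij
    exact ⟨⦋p⦌, SimplexCategory.Hom.mk a, htm.functor, ha, nerve.ext_of_isThin (funext ht)⟩

theorem mem_hornImage_sdPlusOp {n : ℕ} {k : Fin (n + 1)} {m : SimplexCategoryᵒᵖ}
    (s : (nerve (NonemptySubsets.{u} n)ᵒᵈ).obj m) :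
    s ∈ (hornImage sdPlusOp.{u} n k).obj m ↔ ∀ i, InHorn k (OrderDual.ofDual (s.obj i)) := by
  constructor
  · rintro ⟨p, a, t, ha, rfl⟩ i
    exact inHorn_image a.toOrderHom ha (OrderDual.ofDual (t.obj i))
  · intro h
    -- In the opposite poset the largest subset of a chain is its initial vertex, hence the index
    -- `0`.
    obtain ⟨p, a, t, ha, ha', ht⟩ := exists_face_of_inHorn
      (fun i => OrderDual.ofDual (s.obj i)) 0 (fun i => s.monotone (Fin.zero_le i)) (h _)
    have htm : Monotone fun i => OrderDual.toDual (t i) := fun i j hij => by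
      change t j ≤ t i
      rw [← image_le_image_iff a ha', ht, ht]
      exact s.monotone hij
    exact ⟨⦋p⦌, SimplexCategory.Hom.mk a, htm.functor, ha, nerve.ext_of_isThin (funext ht)⟩

section

variable {X : MarkedSSet.{u}} {m n : ℕ} {k : Fin (n + 1)} {l : Fin (m + 1)}

/-- The maps `i` and `p` present `LJ ⊆ LI` as a retract of the marked inclusion attached to an inner
horn. The dimension and vertex of that horn are left free, to allow a larger simplex when `k` is an
end vertex. -/
theorem hasRLP_LJι_of_retract (hX : SSet.Quasicategory (ExPlus.obj X)) (h0 : 0 < l)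
    (hl : l < Fin.last m) (i : SubsetsContaining.{u} n k →o NonemptySubsets.{u} m)
    (p : NonemptySubsets.{u} m →o SubsetsContaining.{u} n k) (hpi : ∀ A, p (i A) = A)
    (hi : ∀ A B, A.1.max = B.1.max → (i A).1.max = (i B).1.max)
    (hp : ∀ A B, A.1.max = B.1.max → (p A).1.max = (p B).1.max)
    (hi' : ∀ A, A ≠ SubsetsContaining.top n k → InHorn l (i A))
    (hp' : ∀ A, InHorn l A → p A ≠ SubsetsContaining.top n k) : X.HasRLP (LJι.{u} n k) := by
  let p' : sdPlus.{u}.obj ⦋m⦌ ⟶ LI.{u} n k := nerveOfMap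
    (f := fun A : NonemptySubsets.{u} m => A.1.max)
    (g := fun A : SubsetsContaining.{u} n k => A.1.max) p hp
  let i' : LI.{u} n k ⟶ sdPlus.{u}.obj ⦋m⦌ := nerveOfMap
    (f := fun A : SubsetsContaining.{u} n k => A.1.max)
    (g := fun A : NonemptySubsets.{u} m => A.1.max) i hi
  refine (hasRLP_hornImage (F := sdPlus) hX h0 hl).transfer (A := LJSubcomplex n k) p' i' ?_ ?_ ?_
  · intro d s hs
    exact (mem_omitVertex_nerve _ _).2 fun j => hp' _ ((mem_hornImage_sdPlus s).1 hs j)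
  · intro d s hs
    exact (mem_hornImage_sdPlus _).2 fun j => hi' _ ((mem_omitVertex_nerve _ s).1 hs j)
  · intro d s _
    exact nerve.ext_of_isThin (funext fun j => hpi _)

theorem hasRLP_RJι_of_retract (hX : SSet.Quasicategory (ExPlusOp.obj X)) (h0 : 0 < l)
    (hl : l < Fin.last m) (i : SubsetsContaining.{u} n k →o NonemptySubsets.{u} m)
    (p : NonemptySubsets.{u} m →o SubsetsContaining.{u} n k) (hpi : ∀ A, p (i A) = A)
    (hi : ∀ A B, A.1.min = B.1.min → (i A).1.min = (i B).1.min)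
    (hp : ∀ A B, A.1.min = B.1.min → (p A).1.min = (p B).1.min)
    (hi' : ∀ A, A ≠ SubsetsContaining.top n k → InHorn l (i A))
    (hp' : ∀ A, InHorn l A → p A ≠ SubsetsContaining.top n k) : X.HasRLP (RJι.{u} n k) := by
  let p' : sdPlusOp.{u}.obj ⦋m⦌ ⟶ RI.{u} n k := nerveOfMap
    (f := fun A : (NonemptySubsets.{u} m)ᵒᵈ => (OrderDual.ofDual A).1.min)
    (g := fun A : (SubsetsContaining.{u} n k)ᵒᵈ => (OrderDual.ofDual A).1.min) p.dual hp
  let i' : RI.{u} n k ⟶ sdPlusOp.{u}.obj ⦋m⦌ := nerveOfMap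
    (f := fun A : (SubsetsContaining.{u} n k)ᵒᵈ => (OrderDual.ofDual A).1.min)
    (g := fun A : (NonemptySubsets.{u} m)ᵒᵈ => (OrderDual.ofDual A).1.min) i.dual hi
  refine (hasRLP_hornImage (F := sdPlusOp) hX h0 hl).transfer (A := RJSubcomplex n k) p' i' ?_ ?_ ?_
  · intro d s hs
    exact (mem_omitVertex_nerve _ _).2 fun j => hp' _ ((mem_hornImage_sdPlusOp s).1 hs j)
  · intro d s hs
    exact (mem_hornImage_sdPlusOp _).2 fun j => hi' _ ((mem_omitVertex_nerve _ s).1 hs j)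
  · intro d s _
    exact nerve.ext_of_isThin (funext fun j => hpi _)

theorem hasRLP_LJι_of_quasicategory (hX : SSet.Quasicategory (ExPlus.obj X)) (hn : 2 ≤ n)
    (hk : 0 < k) : X.HasRLP (LJι.{u} n k) := by
  obtain hk' | rfl := (Fin.le_last k).lt_or_eq
  · refine hasRLP_LJι_of_retract hX hk hk' (ofContaining k) (insertElement k)
      (insertElement_ofContaining k) (fun _ _ h => h) (fun A B h => ?_) (inHorn_ofContaining k)
      (insertElement_ne_top k)
    change (insert k A.1.finset).max = (insert k B.1.finset).max
    rw [Finset.max_insert, Finset.max_insert]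
    exact congrArg _ h
  -- For `k = n`, the inner horn of `[n + 1]` at `n` is used, with the new vertex `n + 1` as the
  -- added point. All values of `addPoint` contain `n + 1` and all values of `removePoint` contain
  -- `n`, so markings are preserved automatically.
  · have hl : (Fin.last (n + 1)).succAbove (Fin.last n) = (Fin.last n).castSucc :=
      Fin.succAbove_last_apply _
    refine hasRLP_LJι_of_retract (l := (Fin.last (n + 1)).succAbove (Fin.last n)) hX
      (hl ▸ Fin.castSucc_pos_iff.2 hk) (hl ▸ Fin.castSucc_lt_last _) (addPoint _ _)
      (removePoint _ _) (removePoint_addPoint _ _) (fun A B _ => ?_) (fun A B _ => ?_)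
      (inHorn_addPoint _ _) (removePoint_ne_top _ _ (by omega))
    · exact (max_eq_last (Finset.mem_insert_self _ _)).trans
        (max_eq_last (Finset.mem_insert_self _ _)).symm
    · exact (max_eq_last (Finset.mem_insert_self _ _)).trans
        (max_eq_last (Finset.mem_insert_self _ _)).symm

theorem hasRLP_RJι_of_quasicategory (hX : SSet.Quasicategory (ExPlusOp.obj X)) (hn : 2 ≤ n)
    (hk : k < Fin.last n) : X.HasRLP (RJι.{u} n k) := by
  obtain hk' | rfl := (Fin.zero_le k).lt_or_eq
  · refine hasRLP_RJι_of_retract hX hk' hk (ofContaining k) (insertElement k)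
      (insertElement_ofContaining k) (fun _ _ h => h) (fun A B h => ?_) (inHorn_ofContaining k)
      (insertElement_ne_top k)
    change (insert k A.1.finset).min = (insert k B.1.finset).min
    rw [Finset.min_insert, Finset.min_insert]
    exact congrArg _ h
  -- Mirror image: a new least point is added, which shifts `k = 0` to the inner vertex `1`.
  · have hl : (0 : Fin (n + 2)).succAbove (0 : Fin (n + 1)) = Fin.succ 0 :=
      Fin.zero_succAbove _
    refine hasRLP_RJι_of_retract (l := (0 : Fin (n + 2)).succAbove 0) hX
      (hl ▸ Fin.succ_pos _) (hl ▸ Fin.succ_lt_succ_iff.2 hk) (addPoint _ _)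
      (removePoint _ _) (removePoint_addPoint _ _) (fun A B _ => ?_) (fun A B _ => ?_)
      (inHorn_addPoint _ _) (removePoint_ne_top _ _ (by omega))
    · exact (min_eq_zero (Finset.mem_insert_self _ _)).trans
        (min_eq_zero (Finset.mem_insert_self _ _)).symm
    · exact (min_eq_zero (Finset.mem_insert_self _ _)).trans
        (min_eq_zero (Finset.mem_insert_self _ _)).symm

theorem quasicategory_exPlus [SSet.Quasicategory X.toSSet] (hX : X.CLF) :
    SSet.Quasicategory (ExPlus.obj X) := by
  refine quasicategory_exOf hasMinimalFaces_sdPlus fun n k hn h0 hk => ?_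
  have h := hasRLP_omitVertex hX.weaklyClosed (p := fun A : SubsetsContaining.{u} n k => A.1.max)
    (q := fun A : NotCompl.{u} k => A.1.1.max) (containingEmb k) (fun _ _ => Iff.rfl)
    (fun A B C hAB hBC hAC => le_antisymm (Finset.max_mono hAB)
      ((Finset.max_mono hBC).trans hAC.ge)) (SubsetsContaining.top n k)
    (NerveChains.Toggle.innerAnodyneExtensions (isStrictClosure k).toggle (mem_sup_iff_of_range _ _))
    (hX.hasRLP n k hn h0)
  let p : nerveOf (NotCompl.{u} k) (fun A => A.1.1.max) ⟶ sdPlus.{u}.obj ⦋n⦌ := nerveOfMap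
    (g := fun A : NonemptySubsets.{u} n => A.1.max) ⟨Subtype.val, fun _ _ h => h⟩ fun _ _ h => h
  let i : sdPlus.{u}.obj ⦋n⦌ ⟶ nerveOf (NotCompl.{u} k) (fun A => A.1.1.max) := nerveOfMap
    (f := fun A : NonemptySubsets.{u} n => A.1.max) (toNotCompl k) fun _ _ hAB =>
      (max_toNotCompl k hk _).trans (hAB.trans (max_toNotCompl k hk _).symm)
  -- The inclusion of `NotCompl k` and the map `toNotCompl k` identify the horn with the chains of
  -- `NotCompl k` avoiding `[n]`; neither kind of chain meets `[n] \ {k}`, the one vertex that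
  -- `toNotCompl k` moves.
  refine h.transfer p i ?_ ?_ ?_
  · intro d s hs
    refine (mem_hornImage_sdPlus _).2 fun j => (inHorn_iff _).2 ⟨fun h => ?_, (s.obj j).2⟩
    exact (mem_omitVertex_nerve _ s).1 hs j (Subtype.ext (ext_finset h))
  · intro d s hs
    refine (mem_omitVertex_nerve _ _).2 fun j hj => ?_
    have hs' := (inHorn_iff _).1 ((mem_hornImage_sdPlus s).1 hs j)
    have hj' := (toNotCompl_of_ne k hs'.2).symm.trans hj
    exact hs'.1 (congrArg (fun A : NotCompl.{u} k => A.1.1.finset) hj')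
  · intro d s hs
    refine nerve.ext_of_isThin (funext fun j => ?_)
    have hs' := (inHorn_iff _).1 ((mem_hornImage_sdPlus s).1 hs j)
    exact congrArg Subtype.val (toNotCompl_of_ne k hs'.2)

theorem quasicategory_exPlusOp [SSet.Quasicategory X.toSSet] (hX : X.CRF) :
    SSet.Quasicategory (ExPlusOp.obj X) := by
  refine quasicategory_exOf hasMinimalFaces_sdPlusOp fun n k hn h0 hk => ?_
  have h := hasRLP_omitVertex hX.weaklyClosed
    (p := fun A : (SubsetsContaining.{u} n k)ᵒᵈ => (OrderDual.ofDual A).1.min)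
    (q := fun A : (NotCompl.{u} k)ᵒᵈ => (OrderDual.ofDual A).1.1.min) (containingEmb k).dual
    (fun _ _ => Iff.rfl)
    (fun A B C hAB hBC hAC => le_antisymm
      (Finset.min_mono (show (OrderDual.ofDual B).1.1.finset ⊆ _ from hAB))
      ((Finset.min_mono (show (OrderDual.ofDual C).1.1.finset ⊆ _ from hBC)).trans hAC.ge))
    (OrderDual.toDual (SubsetsContaining.top n k))
    (NerveChains.Toggle.innerAnodyneExtensions (isStrictClosure k).toggle.dual (mem_sup_iff_of_range _ _))
    (hX.hasRLP n k hn hk)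
  let p : nerveOf (NotCompl.{u} k)ᵒᵈ (fun A => (OrderDual.ofDual A).1.1.min) ⟶
      sdPlusOp.{u}.obj ⦋n⦌ := nerveOfMap
    (g := fun A : (NonemptySubsets.{u} n)ᵒᵈ => (OrderDual.ofDual A).1.min)
    (OrderHom.dual ⟨Subtype.val, fun _ _ h => h⟩) fun _ _ h => h
  let i : sdPlusOp.{u}.obj ⦋n⦌ ⟶
      nerveOf (NotCompl.{u} k)ᵒᵈ (fun A => (OrderDual.ofDual A).1.1.min) := nerveOfMap
    (f := fun A : (NonemptySubsets.{u} n)ᵒᵈ => (OrderDual.ofDual A).1.min)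
    (toNotCompl k).dual fun _ _ hAB =>
      (min_toNotCompl k h0 _).trans (hAB.trans (min_toNotCompl k h0 _).symm)
  refine h.transfer p i ?_ ?_ ?_
  · intro d s hs
    refine (mem_hornImage_sdPlusOp _).2 fun j => (inHorn_iff _).2
      ⟨fun h => ?_, (OrderDual.ofDual (s.obj j)).2⟩
    exact (mem_omitVertex_nerve _ s).1 hs j (Subtype.ext (ext_finset h))
  · intro d s hs
    refine (mem_omitVertex_nerve _ _).2 fun j hj => ?_
    have hs' := (inHorn_iff _).1 ((mem_hornImage_sdPlusOp s).1 hs j)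
    have hj' := (toNotCompl_of_ne k hs'.2).symm.trans hj
    exact hs'.1 (congrArg (fun A : NotCompl.{u} k => A.1.1.finset) hj')
  · intro d s hs
    refine nerve.ext_of_isThin (funext fun j => ?_)
    have hs' := (inHorn_iff _).1 ((mem_hornImage_sdPlusOp s).1 hs j)
    exact congrArg Subtype.val (toNotCompl_of_ne k hs'.2)

end

end MarkedSSet

theorem mainTheorem2 (X : MarkedSSet.{u}) :
    ((SSet.Quasicategory (MarkedSSet.ExPlus.obj X) →
        ∀ (n : ℕ) (k : Fin (n + 1)), 2 ≤ n → 0 < k → X.HasRLP (MarkedSSet.LJι n k)) ∧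
      (SSet.Quasicategory X.toSSet → X.CLF →
        SSet.Quasicategory (MarkedSSet.ExPlus.obj X))) ∧
    ((SSet.Quasicategory (MarkedSSet.ExPlusOp.obj X) →
        ∀ (n : ℕ) (k : Fin (n + 1)), 2 ≤ n → k < Fin.last n →
          X.HasRLP (MarkedSSet.RJι n k)) ∧
      (SSet.Quasicategory X.toSSet → X.CRF →
        SSet.Quasicategory (MarkedSSet.ExPlusOp.obj X))) :=
  ⟨⟨fun h _ _ hn hk => MarkedSSet.hasRLP_LJι_of_quasicategory h hn hk,
      fun _ h => MarkedSSet.quasicategory_exPlus h⟩,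
    ⟨fun h _ _ hn hk => MarkedSSet.hasRLP_RJι_of_quasicategory h hn hk,
      fun _ h => MarkedSSet.quasicategory_exPlusOp h⟩⟩
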